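/- **Setting.** Modal formulae are generated by $\varphi ::= p \mid \neg p \mid \varphi\lor\varphi \mid \varphi\land\varphi \mid \Diamond\varphi \mid \Box\varphi$ with $p$ from a denumerable set of atoms; $\overline{\varphi}$ denotes the negation of $\varphi$, i.e. $\overline{p}=\neg p$, $\overline{\neg p}=p$, $\overline{\psi\lor\chi}=\overline\psi\land\overline\chi$, $\overline{\psi\land\chi}=\overline\psi\lor\overline\chi$, $\overline{\Diamond\psi}=\Box\overline\psi$, $\overline{\Box\psi}=\Diamond\overline\psi$. A *quasi-density property* is a first-order formula $\forall x,y\,(R^{k}(x,y)\to R^{n}(x,y))$ with $0<k<n$; it is identified with the rule $R(x,y_1)\land\dots\land R(y_{k-1},y)\to\exists z_1\cdots z_{n-1}\; R(x,z_1)\land\dots\land R(z_{n-1},y)$. Terms are words over the disjoint union of denumerable sets of constants and variables. An *instance* is a set of atoms, each of the form $\mathsf{contr}$ (nullary), $P_\psi(t)$ ($\psi$ a modal formula), $R(t,s)$ or $E(t,s)$, where $t,s$ are terms. A *rule* is a formula $\forall \vec x\,(\beta(\vec x)\to\bigvee_i\exists\vec z_i\,\alpha_i(\vec x,\vec z_i))$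 with $\beta,\alpha_i$ finite conjunctions of atoms over constants and variables. A *trigger* in an instance $I$ is a pair $(\rho,h)$ of a rule $\rho$ and a map $h$ of the variables of its body $\beta$ to terms that sends every atom of $\beta$ into $I$; it is *active* in $I$ if for no disjunct $\alpha_i$ the map $h$ extends to $\vec z_i$ so that also every atom of $\alpha_i$ is sent into $I$. *Applying* an active trigger $(\rho,h)$ to $I$ yields, for a choice of a disjunct $\alpha_i$, the instance $I\cup\alpha_i(h(\vec x),\vec t)$, where $\vec t$ consists of pairwise distinct fresh terms (not constants and not occurring in $I$). A *fair derivation sequence* of $I$ and a rule set $\mathcal R$ is a finite or infinite sequence $I=I_0,I_1,\dots$ in which each $I_{i+1}$ results from applying to $I_i$ an active trigger with a rule of $\mathcal R$, and in which no trigger with a rule of $\mathcal R$ stays active indefinitely (so a finite sequence ends in an instance without active triggers). The *chase* $\mathrm{Ch}(I,\mathcal R)$ is the set of the unions $\bigcup_i I_i$ of all fair derivation sequences of $I$ and $\mathcal R$. For a modal formula $\varphi$ let $\mathcal R_\varphi$ consist of the rules - $P_{\psi\land\chi}(x)\to P_\psi(x)\land P_\chi(x)$, - $P_{\psi\lor\chi}(x)\to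 P_\psi(x)\lor P_\chi(x)$, - $P_{\Box\psi}(x)\land R(x,y)\to P_\psi(y)$, - $P_{\Diamond\psi}(x)\to\exists y\,(R(x,y)\land E(x,y)\land P_\psi(y))$, - $P_\psi(x)\land P_{\overline\psi}(x)\to\mathsf{contr}$, for $\psi,\chi$ ranging over the sub-formulae of $\varphi$. Let $a$ be a fixed constant. **Lemma 4.1.** The following problem is decidable. Input: a finite set $\mathcal P$ of quasi-density properties (each given by its pair $(k,n)$) and a modal formula $\varphi$. Question: is there a $\mathcal C\in\mathrm{Ch}(\{P_\varphi(a)\},\mathcal R_\varphi\cup\mathcal P)$ with $\mathsf{contr}\notin\mathcal C$? That is, there is one algorithm which answers this question correctly for all $\mathcal P$ and $\varphi$. -/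

import Mathlib

namespace QuasiDense

/-! ### Modal formulae -/

/-- Modal formulae in negation normal form; the propositional atoms are the natural numbers. -/
inductive ModalFormula : Type
  | atom (p : ℕ) : ModalFormula
  | natom (p : ℕ) : ModalFormula
  | or (ψ χ : ModalFormula) : ModalFormula
  | and (ψ χ : ModalFormula) : ModalFormula
  | dia (ψ : ModalFormula) : ModalFormula
  | box (ψ : ModalFormula) : ModalFormula
  deriving DecidableEq

namespace ModalFormula

/-- The (defined) negation of a formula. -/
def neg : ModalFormula → ModalFormula
  | atom p => natom p
  | natom p => atom p
  | or ψ χ => and ψ.neg χ.neg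
  | and ψ χ => or ψ.neg χ.neg
  | dia ψ => box ψ.neg
  | box ψ => dia ψ.neg

/-- The set of sub-formulae of a formula (including the formula itself). -/
def subformulae : ModalFormula → Set ModalFormula
  | atom p => {atom p}
  | natom p => {natom p, atom p}
  | or ψ χ => {or ψ χ} ∪ (ψ.subformulae ∪ χ.subformulae)
  | and ψ χ => {and ψ χ} ∪ (ψ.subformulae ∪ χ.subformulae)
  | dia ψ => {dia ψ} ∪ ψ.subformulae
  | box ψ => {box ψ} ∪ ψ.subformulae

/-- Gödel numbering of the modal formulae. -/
def toNat : ModalFormula → ℕ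
  | atom p => 6 * p
  | natom p => 6 * p + 1
  | or ψ χ => 6 * Nat.pair ψ.toNat χ.toNat + 2
  | and ψ χ => 6 * Nat.pair ψ.toNat χ.toNat + 3
  | dia ψ => 6 * ψ.toNat + 4
  | box ψ => 6 * ψ.toNat + 5

/-- The formula with a given Gödel number. -/
def ofNat (m : ℕ) : ModalFormula :=
  if h : m % 6 = 0 then atom (m / 6)
  else if m % 6 = 1 then natom (m / 6)
  else if h : m % 6 = 2 then
    have : (Nat.unpair (m / 6)).1 < m := lt_of_le_of_lt (Nat.unpair_left_le _) (by omega)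
    have : (Nat.unpair (m / 6)).2 < m := lt_of_le_of_lt (Nat.unpair_right_le _) (by omega)
    or (ofNat (Nat.unpair (m / 6)).1) (ofNat (Nat.unpair (m / 6)).2)
  else if h : m % 6 = 3 then
    have : (Nat.unpair (m / 6)).1 < m := lt_of_le_of_lt (Nat.unpair_left_le _) (by omega)
    have : (Nat.unpair (m / 6)).2 < m := lt_of_le_of_lt (Nat.unpair_right_le _) (by omega)
    and (ofNat (Nat.unpair (m / 6)).1) (ofNat (Nat.unpair (m / 6)).2)
  else if h : m % 6 = 4 then
    have : m / 6 < m := by omega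
    dia (ofNat (m / 6))
  else
    have : m / 6 < m := by omega
    box (ofNat (m / 6))
termination_by m

theorem ofNat_toNat (φ : ModalFormula) : ofNat φ.toNat = φ := by
  induction φ with
  | atom p => rw [toNat, ofNat]; simp
  | natom p =>
    have h1 : (6 * p + 1) % 6 = 1 := by omega
    have h2 : (6 * p + 1) / 6 = p := by omega
    rw [toNat, ofNat]; simp [h1, h2]
  | or ψ χ ihψ ihχ =>
    have h1 : (6 * Nat.pair ψ.toNat χ.toNat + 2) % 6 = 2 := by omega
    have h2 : (6 * Nat.pair ψ.toNat χ.toNat + 2) / 6 = Nat.pair ψ.toNat χ.toNat := by omega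
    rw [toNat, ofNat]; simp [h1, h2, ihψ, ihχ]
  | and ψ χ ihψ ihχ =>
    have h1 : (6 * Nat.pair ψ.toNat χ.toNat + 3) % 6 = 3 := by omega
    have h2 : (6 * Nat.pair ψ.toNat χ.toNat + 3) / 6 = Nat.pair ψ.toNat χ.toNat := by omega
    rw [toNat, ofNat]; simp [h1, h2, ihψ, ihχ]
  | dia ψ ih =>
    have h1 : (6 * ψ.toNat + 4) % 6 = 4 := by omega
    have h2 : (6 * ψ.toNat + 4) / 6 = ψ.toNat := by omega
    rw [toNat, ofNat]; simp [h1, h2, ih]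
  | box ψ ih =>
    have h1 : (6 * ψ.toNat + 5) % 6 = 5 := by omega
    have h2 : (6 * ψ.toNat + 5) / 6 = ψ.toNat := by omega
    rw [toNat, ofNat]; simp [h1, h2, ih]

theorem toNat_ofNat (m : ℕ) : (ofNat m).toNat = m := by
  induction m using Nat.strong_induction_on with
  | _ m ih =>
    have hl : (Nat.unpair (m / 6)).1 ≤ m / 6 := Nat.unpair_left_le _
    have hr : (Nat.unpair (m / 6)).2 ≤ m / 6 := Nat.unpair_right_le _
    rw [ofNat]
    split_ifs with h0 h1 h2 h3 h4
    · simp only [toNat]; omega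
    · simp only [toNat]; omega
    · simp only [toNat]
      rw [ih _ (by omega), ih _ (by omega), Nat.pair_unpair]; omega
    · simp only [toNat]
      rw [ih _ (by omega), ih _ (by omega), Nat.pair_unpair]; omega
    · simp only [toNat]
      rw [ih _ (by omega)]; omega
    · simp only [toNat]
      rw [ih _ (by omega)]; omega

/-- The Gödel numbering as a bijection. -/
def equivNat : ModalFormula ≃ ℕ where
  toFun := toNat
  invFun := ofNat
  left_inv := ofNat_toNat
  right_inv := toNat_ofNat

/-- Formulae as inputs of algorithms: a formula is given by its Gödel number. -/
instance : Primcodable ModalFormula := Primcodable.ofEquiv ℕ equivNat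

end ModalFormula

/-! ### Quasi-density properties -/

/-- The quasi-density property `∀ x y, R^k(x,y) → R^n(x,y)` with `0 < k < n`,
given by the pair `(k, n)`. -/
abbrev QDP : Type := {p : ℕ × ℕ // 0 < p.1 ∧ p.1 < p.2}

theorem primrecPred_qdp : PrimrecPred fun p : ℕ × ℕ => 0 < p.1 ∧ p.1 < p.2 :=
  (Primrec.nat_lt.comp (Primrec.const 0) Primrec.fst).and
    (Primrec.nat_lt.comp Primrec.fst Primrec.snd)

/-- A quasi-density property as an input of an algorithm is given by the pair `(k, n)`. -/
instance : Primcodable QDP := Primcodable.subtype primrecPred_qdp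

/-! ### Terms, atoms, instances -/

/-- Constants. -/
abbrev Const : Type := ℕ

/-- Variables. -/
abbrev Var : Type := ℕ

/-- Terms are words over the disjoint union of the constants and the variables. -/
abbrev Term : Type := List (Const ⊕ Var)

/-- A constant, as a term. -/
def Term.const (c : Const) : Term := [Sum.inl c]

/-- The two binary predicates. -/
inductive BinPred : Type
  | R : BinPred
  | E : BinPred
  deriving DecidableEq

/-- Atoms with arguments from `τ`: the nullary `contr`, the unary `P_ψ(t)` for modal formulae
`ψ`, and the binary `R(t,s)`, `E(t,s)`. -/
inductive Atom (τ : Type) : Type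
  | contr : Atom τ
  | P (ψ : ModalFormula) (t : τ) : Atom τ
  | bin (b : BinPred) (t s : τ) : Atom τ
  deriving DecidableEq

namespace Atom

/-- The arguments of an atom. -/
def args {τ : Type} : Atom τ → Set τ
  | contr => ∅
  | P _ t => {t}
  | bin _ t s => {t, s}

/-- Apply a function to the arguments of an atom. -/
def map {τ σ : Type} (f : τ → σ) : Atom τ → Atom σ
  | contr => contr
  | P ψ t => P ψ (f t)
  | bin b t s => bin b (f t) (f s)

end Atom

/-- An instance is a (possibly infinite) set of atoms over terms. -/
abbrev Instance : Type := Set (Atom Term)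

/-- The terms of an instance. -/
def Instance.terms (I : Instance) : Set Term := {t | ∃ A ∈ I, t ∈ A.args}

/-! ### Disjunctive existential rules -/

/-- Atoms of rules: the arguments are constants and variables. -/
abbrev RuleAtom : Type := Atom (Const ⊕ Var)

/-- A disjunctive existential rule `∀ x y, β(x,y) → ⋁ᵢ ∃ zᵢ, αᵢ(yᵢ,zᵢ)`. The body `β` and each
disjunct `αᵢ` of the head are finite conjunctions of atoms, given as finite sets; the variables of
a disjunct that do not occur in the body are the existentially quantified ones. -/
structure Rule : Type where
  body : Finset RuleAtom
  head : List (Finset RuleAtom)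

/-- The variables of a conjunction of atoms. -/
def vars (α : Finset RuleAtom) : Set Var := {v | ∃ A ∈ α, Sum.inr v ∈ A.args}

/-- The existentially quantified variables of a disjunct `α` of the head of `ρ`. -/
def Rule.exVars (ρ : Rule) (α : Finset RuleAtom) : Set Var := vars α \ vars ρ.body

/-- The action of an assignment of terms to variables on the arguments of rule atoms; constants
are mapped to themselves. -/
def subst (h : Var → Term) : Const ⊕ Var → Term
  | Sum.inl c => Term.const c
  | Sum.inr v => h v

/-- `h` maps the conjunction of atoms `α` homomorphically to the instance `I`. -/
def MapsTo (h : Var → Term) (α : Finset RuleAtom) (I : Instance) : Prop :=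
  ∀ A ∈ α, A.map (subst h) ∈ I

/-- The pair `(ρ, h)` is a trigger in `I`. Only the values of `h` on the variables of the body of
`ρ` matter. -/
def IsTrigger (ρ : Rule) (h : Var → Term) (I : Instance) : Prop := MapsTo h ρ.body I

/-- The trigger `(ρ, h)` is active in `I`: for no disjunct `α` of the head can `h` (as a map on
the variables of the body) be extended to a map of the body and `α` to `I`. -/
def IsActive (ρ : Rule) (h : Var → Term) (I : Instance) : Prop :=
  IsTrigger ρ h I ∧
    ¬ ∃ α ∈ ρ.head, ∃ h' : Var → Term,
      Set.EqOn h' h (vars ρ.body) ∧ MapsTo h' ρ.body I ∧ MapsTo h' α I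

/-- The possible results of applying the trigger `(ρ, h)` to `I`: for some disjunct `α` of the
head, the image of `α` is added to `I`, where the existential variables are replaced by pairwise
distinct fresh terms, i.e. terms which are not constants and do not occur in `I`. -/
def applyTrigger (I : Instance) (ρ : Rule) (h : Var → Term) : Set Instance :=
  {J | ∃ α ∈ ρ.head, ∃ h' : Var → Term,
    Set.EqOn h' h (vars ρ.body) ∧
    Set.InjOn h' (ρ.exVars α) ∧
    (∀ z ∈ ρ.exVars α, h' z ∉ I.terms ∧ ∀ c : Const, h' z ≠ Term.const c) ∧
    J = I ∪ Atom.map (subst h') '' (α : Set RuleAtom)}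

/-! ### The disjunctive chase -/

/-- `J 0, J 1, …` is a fair derivation sequence of `I` and `𝓡`. The sequence has `N` steps, where
`N = ⊤` for an infinite sequence; if `N` is finite, then its members are `J 0, …, J N` and the
other values of `J` play no role. -/
structure IsFairDerivation (I : Instance) (𝓡 : Set Rule) (N : ℕ∞) (J : ℕ → Instance) :
    Prop where
  zero : J 0 = I
  step : ∀ i : ℕ, (i : ℕ∞) < N →
    ∃ ρ ∈ 𝓡, ∃ h : Var → Term, IsActive ρ h (J i) ∧ J (i + 1) ∈ applyTrigger (J i) ρ h
  /-- No trigger remains active indefinitely (up to the end of the sequence, if it is finite). -/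
  fair : ∀ ρ ∈ 𝓡, ∀ h : Var → Term, ∀ i : ℕ, (i : ℕ∞) ≤ N → IsActive ρ h (J i) →
    ∃ j : ℕ, i ≤ j ∧ (j : ℕ∞) ≤ N ∧ ¬ IsActive ρ h (J j)

/-- The disjunctive chase: the set of the unions of all fair derivation sequences. -/
def chase (I : Instance) (𝓡 : Set Rule) : Set Instance :=
  {C | ∃ (N : ℕ∞) (J : ℕ → Instance), IsFairDerivation I 𝓡 N J ∧
    C = {A | ∃ i : ℕ, (i : ℕ∞) ≤ N ∧ A ∈ J i}}

/-! ### The rules for modal formulae and quasi-density properties -/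

/-- The atom `P_ψ(v)` for a variable `v`. -/
def atomP (ψ : ModalFormula) (v : Var) : RuleAtom := Atom.P ψ (Sum.inr v)

/-- The atom `R(v,w)` for variables `v`, `w`. -/
def atomR (v w : Var) : RuleAtom := Atom.bin BinPred.R (Sum.inr v) (Sum.inr w)

/-- The atom `E(v,w)` for variables `v`, `w`. -/
def atomE (v w : Var) : RuleAtom := Atom.bin BinPred.E (Sum.inr v) (Sum.inr w)

/-- `P_{ψ∧χ}(x) → P_ψ(x) ∧ P_χ(x)` -/
def andRule (ψ χ : ModalFormula) : Rule :=
  ⟨{atomP (.and ψ χ) 0}, [{atomP ψ 0, atomP χ 0}]⟩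

/-- `P_{ψ∨χ}(x) → P_ψ(x) ∨ P_χ(x)` -/
def orRule (ψ χ : ModalFormula) : Rule :=
  ⟨{atomP (.or ψ χ) 0}, [{atomP ψ 0}, {atomP χ 0}]⟩

/-- `P_{□ψ}(x) ∧ R(x,y) → P_ψ(y)` -/
def boxRule (ψ : ModalFormula) : Rule :=
  ⟨{atomP (.box ψ) 0, atomR 0 1}, [{atomP ψ 1}]⟩

/-- `P_{◇ψ}(x) → ∃ y, R(x,y) ∧ E(x,y) ∧ P_ψ(y)` -/
def diaRule (ψ : ModalFormula) : Rule :=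
  ⟨{atomP (.dia ψ) 0}, [{atomR 0 1, atomE 0 1, atomP ψ 1}]⟩

/-- `P_ψ(x) ∧ P_{¬ψ}(x) → contr` -/
def contrRule (ψ : ModalFormula) : Rule :=
  ⟨{atomP ψ 0, atomP ψ.neg 0}, [{Atom.contr}]⟩

/-- The rule set `R_φ`. -/
def modalRules (φ : ModalFormula) : Set Rule :=
  {ρ | ∃ ψ ∈ φ.subformulae, ∃ χ ∈ φ.subformulae, ρ = andRule ψ χ ∨ ρ = orRule ψ χ} ∪
  {ρ | ∃ ψ ∈ φ.subformulae, ρ = boxRule ψ ∨ ρ = diaRule ψ ∨ ρ = contrRule ψ}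

/-- The vertices of the head path of the rule of `(k, n)`: variable `0` at the start, variable `k`
at the end (position `n`), and the variables `k + 1, …, k + n - 1` in between. -/
def headVertex (k n j : ℕ) : Var := if j = 0 then 0 else if j = n then k else k + j

/-- `R(x,y₁) ∧ ⋯ ∧ R(y_{k-1},y) → ∃ z₁ … z_{n-1}, R(x,z₁) ∧ ⋯ ∧ R(z_{n-1},y)`, where `x` is
variable `0`, `yᵢ` is variable `i`, `y` is variable `k`, and `zⱼ` is variable `k + j`. -/
def qdpRule (p : QDP) : Rule :=
  ⟨(Finset.range p.1.1).image fun i => atomR i (i + 1),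
   [(Finset.range p.1.2).image fun j =>
      atomR (headVertex p.1.1 p.1.2 j) (headVertex p.1.1 p.1.2 (j + 1))]⟩

/-- A finite set of quasi-density properties (given by a list) as a rule set. -/
def qdpRules (𝓟 : List QDP) : Set Rule := {ρ | ∃ p ∈ 𝓟, ρ = qdpRule p}

/-- The database `{P_φ(a)}`. -/
def database (a : Const) (φ : ModalFormula) : Instance := {Atom.P φ (Term.const a)}

end QuasiDense

namespace QuasiDense

open Set

/-! ### Kripke semantics -/

/-! A member of the chase without `contr` exists iff `φ` is satisfiable in a Kripke model whose
relation has the properties in `𝓟` (`exists_mem_chase_iff`). Such a member, read as a Kripke model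
on terms, satisfies `φ`, because fairness makes every rule true in the union. Conversely, a model
guides a derivation: each applied disjunct is one that is true in the model, so a homomorphism into
the model survives and `contr` never appears.

Satisfiability is decidable by a bounded model property. Up to `m`-bisimilarity over finitely many
atoms there are finitely many worlds. Take as nodes the pairs of a level `i ≤ d` and a `(d -
i)`-bisimilarity class, and let an edge from level `i` lead to any level `j ≤ i + 1`, provided that
for `i < d` the source has a successor that is `(d - i - 1)`-bisimilar to the target. Levels record
how much precision is left. A path of length `k` in this quotient lifts to a path of the model,
losing one unit of precision per step. The model replaces it by a path of length `n > k`, which has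
used up at least as much precision when it arrives, so its last edge can be directed to the original
end node. At level `d` no precision is left and edges constrain only levels, so longer paths cost
nothing. Hence quasi-density passes to the quotient (`quasiDenseRel_edge`), and so does the truth of
formulae of small degree.

The size of the quotient is bounded by an iterated exponential in the code of `φ`. Relation and
labelling are coded as bits of two numbers, and the bounded search for them is primitive recursive
(`satisfiable_iff`, `primrecPred_satisfiable`). -/

/-- Kripke models over the set of worlds `W`. -/
structure Kripke (W : Type) where
  R : W → W → Prop
  V : ℕ → W → Prop

/-- Truth of a modal formula at a world. -/
def Sat {W : Type} (M : Kripke W) : ModalFormula → W → Prop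
  | .atom p, w => M.V p w
  | .natom p, w => ¬ M.V p w
  | .or ψ χ, w => Sat M ψ w ∨ Sat M χ w
  | .and ψ χ, w => Sat M ψ w ∧ Sat M χ w
  | .dia ψ, w => ∃ v, M.R w v ∧ Sat M ψ v
  | .box ψ, w => ∀ v, M.R w v → Sat M ψ v

theorem sat_neg {W : Type} (M : Kripke W) (ψ : ModalFormula) (w : W) :
    Sat M ψ.neg w ↔ ¬ Sat M ψ w := by
  induction ψ generalizing w with
  | atom p => rfl
  | natom p => simp [ModalFormula.neg, Sat]
  | or ψ χ ihψ ihχ => simp [ModalFormula.neg, Sat, ihψ, ihχ]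
  | and ψ χ ihψ ihχ => simp only [ModalFormula.neg, Sat, ihψ, ihχ]; tauto
  | dia ψ ih => simp [ModalFormula.neg, Sat, ih]
  | box ψ ih => simp [ModalFormula.neg, Sat, ih]

/-- The first `n` steps of `p` follow the relation `R`. -/
def Walk {W : Type} (R : W → W → Prop) (n : ℕ) (p : ℕ → W) : Prop :=
  ∀ i < n, R (p i) (p (i + 1))

/-- The relation `R` has the quasi-density properties in `𝓟`. -/
def QuasiDenseRel {W : Type} (R : W → W → Prop) (𝓟 : List QDP) : Prop :=
  ∀ q ∈ 𝓟, ∀ p : ℕ → W, Walk R q.1.1 p →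
    ∃ p' : ℕ → W, Walk R q.1.2 p' ∧ p' 0 = p 0 ∧ p' q.1.2 = p q.1.1

/-- The formula `φ` is satisfiable over the frames with the quasi-density properties in `𝓟`. -/
def Satisfiable (𝓟 : List QDP) (φ : ModalFormula) : Prop :=
  ∃ (W : Type) (M : Kripke W) (w : W), QuasiDenseRel M.R 𝓟 ∧ Sat M φ w

/-! ### Atoms and rules -/

namespace Atom

variable {τ σ υ : Type}

theorem map_map (f : τ → σ) (g : σ → υ) (A : Atom τ) : (A.map f).map g = A.map (g ∘ f) := by
  cases A <;> rfl

theorem map_congr {f g : τ → σ} {A : Atom τ} (h : ∀ t ∈ A.args, f t = g t) :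
    A.map f = A.map g := by
  cases A <;> simp_all [map, args]

theorem args_map (f : τ → σ) (A : Atom τ) : (A.map f).args = f '' A.args := by
  cases A <;> simp [map, args, Set.image_pair]

theorem finite_args (A : Atom τ) : A.args.Finite := by
  cases A <;> simp [args]

/-- The constructors of atoms as a sum type. -/
def toSum : Atom τ → Unit ⊕ (ModalFormula × τ) ⊕ (Bool × τ × τ)
  | contr => Sum.inl ()
  | P ψ t => Sum.inr (Sum.inl (ψ, t))
  | bin .R t s => Sum.inr (Sum.inr (true, t, s))
  | bin .E t s => Sum.inr (Sum.inr (false, t, s))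

theorem toSum_injective : Function.Injective (toSum (τ := τ)) := by
  rintro (_ | ⟨_, _⟩ | ⟨_ | _, _, _⟩) (_ | ⟨_, _⟩ | ⟨_ | _, _, _⟩) h <;> simp_all [toSum]

end Atom

instance : Countable ModalFormula := ModalFormula.equivNat.injective.countable

instance {τ : Type} [Countable τ] : Countable (Atom τ) := Atom.toSum_injective.countable

instance : Countable Rule :=
  Function.Injective.countable (f := fun ρ : Rule => (ρ.body, ρ.head)) (by
    rintro ⟨b, h⟩ ⟨b', h'⟩ e; simp_all)

theorem finite_vars (α : Finset RuleAtom) : (vars α).Finite := by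
  have : vars α = ⋃ A ∈ α, Sum.inr ⁻¹' A.args := by
    ext v; simp [vars]
  rw [this]
  exact α.finite_toSet.biUnion fun A _ => A.finite_args.preimage (Sum.inr_injective.injOn)

theorem finite_terms {I : Instance} (hI : I.Finite) : I.terms.Finite := by
  have : I.terms = ⋃ A ∈ I, A.args := by
    ext v; simp [Instance.terms]
  rw [this]
  exact hI.biUnion fun A _ => A.finite_args

theorem MapsTo.mono {h : Var → Term} {α : Finset RuleAtom} {I J : Instance} (hm : MapsTo h α I)
    (hIJ : I ⊆ J) : MapsTo h α J := fun A hA => hIJ (hm A hA)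

theorem MapsTo.congr {h h' : Var → Term} {α : Finset RuleAtom} {I : Instance} (hm : MapsTo h α I)
    (e : EqOn h' h (vars α)) : MapsTo h' α I := by
  intro A hA
  rw [Atom.map_congr (g := subst h)]
  · exact hm A hA
  · rintro (c | v) ht
    · rfl
    · exact e ⟨A, hA, ht⟩

/-- The trigger `(ρ, h)` in `I` is satisfied. -/
def IsSatisfied (ρ : Rule) (h : Var → Term) (I : Instance) : Prop :=
  ∃ α ∈ ρ.head, ∃ h' : Var → Term,
    EqOn h' h (vars ρ.body) ∧ MapsTo h' ρ.body I ∧ MapsTo h' α I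

theorem IsSatisfied.mono {ρ : Rule} {h : Var → Term} {I J : Instance} (hs : IsSatisfied ρ h I)
    (hIJ : I ⊆ J) : IsSatisfied ρ h J := by
  obtain ⟨α, hα, h', e, hb, hm⟩ := hs
  exact ⟨α, hα, h', e, hb.mono hIJ, hm.mono hIJ⟩

theorem IsActive.congr {ρ : Rule} {h h' : Var → Term} {I : Instance} (ha : IsActive ρ h I)
    (e : EqOn h' h (vars ρ.body)) : IsActive ρ h' I :=
  ⟨ha.1.congr e, fun ⟨α, hα, k, ek, hb, hm⟩ => ha.2 ⟨α, hα, k, ek.trans e, hb, hm⟩⟩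

theorem subset_of_mem_applyTrigger {I J : Instance} {ρ : Rule} {h : Var → Term}
    (hJ : J ∈ applyTrigger I ρ h) : I ⊆ J := by
  obtain ⟨α, -, h', -, -, -, rfl⟩ := hJ
  exact subset_union_left

theorem isSatisfied_of_mem_applyTrigger {I J : Instance} {ρ : Rule} {h : Var → Term}
    (ht : IsTrigger ρ h I) (hJ : J ∈ applyTrigger I ρ h) : IsSatisfied ρ h J := by
  have hIJ := subset_of_mem_applyTrigger hJ
  obtain ⟨α, hα, h', e, -, -, rfl⟩ := hJ
  exact ⟨α, hα, h', e, (ht.congr e).mono hIJ, fun A hA => Or.inr ⟨A, hA, rfl⟩⟩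

/-! ### The chase satisfies its rules -/

section Union

variable {I : Instance} {𝓡 : Set Rule} {N : ℕ∞} {J : ℕ → Instance}

theorem IsFairDerivation.mono (hJ : IsFairDerivation I 𝓡 N J) {i j : ℕ} (hij : i ≤ j)
    (hj : (j : ℕ∞) ≤ N) : J i ⊆ J j := by
  induction j, hij using Nat.le_induction with
  | base => exact Subset.rfl
  | succ j hij ih =>
    have hlt : (j : ℕ∞) < N := lt_of_lt_of_le (by exact_mod_cast Nat.lt_succ_self j) hj
    obtain ⟨ρ, -, h, -, hm⟩ := hJ.step j hlt
    exact (ih hlt.le).trans (subset_of_mem_applyTrigger hm)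

/-- A conjunction is finite and the sequence is increasing, so all its atoms are already present at
one stage. -/
theorem IsFairDerivation.exists_mapsTo (hJ : IsFairDerivation I 𝓡 N J) (h : Var → Term)
    (α : Finset RuleAtom) (hα : MapsTo h α {A | ∃ i : ℕ, (i : ℕ∞) ≤ N ∧ A ∈ J i}) :
    ∃ i : ℕ, (i : ℕ∞) ≤ N ∧ MapsTo h α (J i) := by
  induction α using Finset.induction_on with
  | empty => exact ⟨0, by simp, fun A hA => by simp at hA⟩
  | insert A α _ ih =>
    obtain ⟨i, hi, him⟩ := ih fun B hB => hα B (Finset.mem_insert_of_mem hB)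
    obtain ⟨j, hj, hjm⟩ := hα A (Finset.mem_insert_self _ _)
    have hij : ((max i j : ℕ) : ℕ∞) ≤ N := by
      rcases max_choice i j with e | e <;> rw [e] <;> assumption
    refine ⟨max i j, hij, fun B hB => ?_⟩
    rcases Finset.mem_insert.1 hB with rfl | hB
    · exact hJ.mono (le_max_right _ _) hij hjm
    · exact hJ.mono (le_max_left _ _) hij (him B hB)

theorem IsFairDerivation.isSatisfied (hJ : IsFairDerivation I 𝓡 N J) {ρ : Rule} (hρ : ρ ∈ 𝓡)
    {h : Var → Term} (ht : IsTrigger ρ h {A | ∃ i : ℕ, (i : ℕ∞) ≤ N ∧ A ∈ J i}) :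
    IsSatisfied ρ h {A | ∃ i : ℕ, (i : ℕ∞) ≤ N ∧ A ∈ J i} := by
  obtain ⟨i, hi, him⟩ := hJ.exists_mapsTo h _ ht
  have key : ∃ j : ℕ, (j : ℕ∞) ≤ N ∧ IsSatisfied ρ h (J j) := by
    by_cases hs : IsSatisfied ρ h (J i)
    · exact ⟨i, hi, hs⟩
    · obtain ⟨j, hij, hj, hna⟩ := hJ.fair ρ hρ h i hi ⟨him, hs⟩
      refine ⟨j, hj, ?_⟩
      by_contra hns
      exact hna ⟨him.mono (hJ.mono hij hj), hns⟩
  obtain ⟨j, hj, hs⟩ := key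
  exact hs.mono fun A hA => ⟨j, hj, hA⟩

end Union

theorem isSatisfied_of_mem_chase {I C : Instance} {𝓡 : Set Rule} (hC : C ∈ chase I 𝓡) {ρ : Rule}
    (hρ : ρ ∈ 𝓡) {h : Var → Term} (ht : IsTrigger ρ h C) : IsSatisfied ρ h C := by
  obtain ⟨N, J, hJ, rfl⟩ := hC
  exact hJ.isSatisfied hρ ht

theorem subset_of_mem_chase {I C : Instance} {𝓡 : Set Rule} (hC : C ∈ chase I 𝓡) : I ⊆ C := by
  obtain ⟨N, J, hJ, rfl⟩ := hC
  exact fun A hA => ⟨0, by simp, hJ.zero ▸ hA⟩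

/-! ### Derivations guided by a model of the rules -/

section Guided

variable {W : Type} (c₀ : Const → W) (S : Set (Atom W))

/-- The rule `ρ` holds in the structure with the interpretation `c₀` of the constants in which the
atoms in `S` are true. -/
def Rule.Holds (ρ : Rule) : Prop :=
  ∀ g : Var → W, (∀ A ∈ ρ.body, A.map (Sum.elim c₀ g) ∈ S) →
    ∃ α ∈ ρ.head, ∃ g' : Var → W, EqOn g' g (vars ρ.body) ∧
      ∀ A ∈ α, A.map (Sum.elim c₀ g') ∈ S

/-- The instance `I` is finite and has a homomorphism to the structure given by `c₀` and `S`. -/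
def Guided (I : Instance) : Prop :=
  I.Finite ∧ ∃ g : Term → W, (∀ c, g (Term.const c) = c₀ c) ∧ ∀ A ∈ I, A.map g ∈ S

variable {c₀ S}

/-- The rule is true in the structure under the image of the trigger, which selects a disjunct and
values for its existential variables; the homomorphism is extended by sending the fresh terms to
these values. -/
theorem Guided.exists_applyTrigger {I : Instance} (hI : Guided c₀ S I) {ρ : Rule}
    (hρ : ρ.Holds c₀ S) {h : Var → Term} (ht : IsTrigger ρ h I) :
    ∃ J ∈ applyTrigger I ρ h, Guided c₀ S J := by
  classical
  obtain ⟨hfin, g, hgc, hg⟩ := hI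
  have hcomp : ∀ (k : Term → W) (l : Var → Term), (∀ c, k (Term.const c) = c₀ c) →
      k ∘ subst l = Sum.elim c₀ (k ∘ l) := by
    intro k l hk
    funext x
    rcases x with c | v
    · exact hk c
    · rfl
  obtain ⟨α, hα, g₁, e₁, hg₁⟩ := hρ (g ∘ h) fun A hA => by
    rw [← hcomp g h hgc, ← Atom.map_map]
    exact hg _ (ht A hA)
  -- Freshness is a matter of length: terms of `I` have length at most `b`, constants have length 1,
  -- and the new terms have length at least `b + 2`. The length also encodes the variable, so
  -- distinct variables get distinct terms and `g'` can decode them.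
  obtain ⟨b, hb⟩ := ((finite_terms hfin).image List.length).bddAbove
  have hlen : ∀ t ∈ I.terms, t.length ≤ b := fun t ht => hb ⟨t, ht, rfl⟩
  set fresh : Var → Term := fun v => List.replicate (b + 2 + v) (Sum.inr 0) with hfresh
  have fresh_length : ∀ v, (fresh v).length = b + 2 + v := fun v => by simp [hfresh]
  set h' : Var → Term := fun v => if v ∈ vars ρ.body then h v else fresh v with hh'
  set g' : Term → W := fun t =>
    if ∃ v, t = fresh v then g₁ (t.length - (b + 2)) else g t with hg'
  have g'_fresh : ∀ v, g' (fresh v) = g₁ v := fun v => by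
    have : ∃ w, fresh v = fresh w := ⟨v, rfl⟩
    simp only [hg', if_pos this, fresh_length, Nat.add_sub_cancel_left]
  have g'_short : ∀ t : Term, t.length ≤ b + 1 → g' t = g t := fun t ht => by
    have : ¬ ∃ v, t = fresh v := by
      rintro ⟨v, rfl⟩
      rw [fresh_length] at ht; omega
    simp only [hg', if_neg this]
  have g'_const : ∀ c, g' (Term.const c) = c₀ c := fun c => by
    rw [g'_short _ (by simp [Term.const]), hgc]
  have g'_h' : g' ∘ h' = g₁ := by
    funext v
    by_cases hv : v ∈ vars ρ.body
    · have hmem : h v ∈ I.terms := by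
        obtain ⟨A, hA, hvA⟩ := hv
        exact ⟨_, ht A hA, by rw [Atom.args_map]; exact ⟨_, hvA, rfl⟩⟩
      simp only [Function.comp, hh', if_pos hv]
      rw [g'_short _ ((hlen _ hmem).trans (Nat.le_succ _)), e₁ hv]
      rfl
    · simp only [Function.comp, hh', if_neg hv, g'_fresh]
  refine ⟨_, ⟨α, hα, h', ?_, ?_, ?_, rfl⟩, hfin.union (α.finite_toSet.image _), g', g'_const, ?_⟩
  · intro v hv
    simp only [hh', if_pos hv]
  · intro v hv w hw e
    simp only [hh', if_neg hv.2, if_neg hw.2] at e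
    have := congrArg List.length e
    rw [fresh_length, fresh_length] at this
    exact Nat.add_left_cancel this
  · intro z hz
    simp only [hh', if_neg hz.2]
    refine ⟨fun hm => ?_, fun c e => ?_⟩
    · have := hlen _ hm
      rw [fresh_length] at this; omega
    · have := congrArg List.length e
      rw [fresh_length] at this
      simp [Term.const] at this; omega
  · rintro A (hA | ⟨B, hB, rfl⟩)
    · rw [Atom.map_congr (g := g)]
      · exact hg A hA
      · exact fun t ht => g'_short t ((hlen t ⟨A, hA, ht⟩).trans (Nat.le_succ _))
    · rw [Atom.map_map, hcomp g' h' g'_const, g'_h']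
      exact hg₁ B hB

/-- The assignment given by a list of terms. -/
def assignment (l : List Term) (v : Var) : Term := l.getD v []

/-- There are uncountably many assignments, but only the finitely many body variables matter; lists
of terms make the triggers countable, so that they can be ranked. -/
theorem exists_assignment (ρ : Rule) (h : Var → Term) :
    ∃ l : List Term, EqOn (assignment l) h (vars ρ.body) := by
  obtain ⟨b, hb⟩ := (finite_vars ρ.body).bddAbove
  refine ⟨(List.range (b + 1)).map h, fun v hv => ?_⟩
  have : v < b + 1 := Nat.lt_succ_of_le (hb hv)
  simp [assignment, List.getD, this]

/-- Always applying the active trigger of least rank is fair: an applied trigger is satisfied from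
then on and never recurs, so only finitely many steps can precede a given trigger that stays active.
-/
theorem exists_guided_derivation {I : Instance} (hI : Guided c₀ S I) {𝓡 : Set Rule}
    (h𝓡 : ∀ ρ ∈ 𝓡, ρ.Holds c₀ S) :
    ∃ (N : ℕ∞) (J : ℕ → Instance), IsFairDerivation I 𝓡 N J ∧ ∀ i, Guided c₀ S (J i) := by
  classical
  obtain ⟨rank, hrank⟩ := exists_injective_nat (𝓡 × List Term)
  let Act : 𝓡 × List Term → Instance → Prop := fun t X => IsActive t.1.1 (assignment t.2) X
  have hnext : ∀ X : {X : Instance // Guided c₀ S X}, ∃ Y : {X : Instance // Guided c₀ S X},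
      (∃ t, Act t X.1) → ∃ t, Act t X.1 ∧ (∀ t', Act t' X.1 → rank t ≤ rank t') ∧
        Y.1 ∈ applyTrigger X.1 t.1.1 (assignment t.2) := by
    intro X
    by_cases hX : ∃ t, Act t X.1
    · obtain ⟨t, ht, hmin⟩ := (measure rank).wf.has_min {t | Act t X.1} hX
      obtain ⟨Y, hY, hYg⟩ := X.2.exists_applyTrigger (h𝓡 _ t.1.2) ht.1
      exact ⟨⟨Y, hYg⟩, fun _ => ⟨t, ht, fun t' ht' => not_lt.1 (hmin t' ht'), hY⟩⟩
    · exact ⟨X, fun h => absurd h hX⟩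
  choose next hnext using hnext
  let J : ℕ → {X : Instance // Guided c₀ S X} := fun i => next^[i] ⟨I, hI⟩
  have hJs : ∀ i, J (i + 1) = next (J i) := fun i => Function.iterate_succ_apply' _ _ _
  have act_of : ∀ ρ ∈ 𝓡, ∀ h i, IsActive ρ h (J i).1 →
      ∃ t : 𝓡 × List Term, t.1.1 = ρ ∧ EqOn (assignment t.2) h (vars ρ.body) ∧
        Act t (J i).1 := by
    intro ρ hρ h i ha
    obtain ⟨l, hl⟩ := exists_assignment ρ h
    exact ⟨(⟨ρ, hρ⟩, l), rfl, hl, ha.congr hl⟩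
  by_cases hend : ∃ i, ¬ ∃ t, Act t (J i).1
  · refine ⟨(Nat.find hend : ℕ), fun i => (J i).1, ⟨rfl, ?_, ?_⟩, fun i => (J i).2⟩
    · intro i hi
      have hex : ∃ t, Act t (J i).1 := not_not.1 (Nat.find_min hend (by exact_mod_cast hi))
      obtain ⟨t, ht, -, hm⟩ := hnext (J i) hex
      exact ⟨t.1.1, t.1.2, _, ht, by rw [hJs]; exact hm⟩
    · intro ρ hρ h i hi _
      refine ⟨Nat.find hend, by exact_mod_cast hi, le_rfl, fun ha => ?_⟩
      obtain ⟨t, -, -, ht⟩ := act_of ρ hρ h _ ha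
      exact Nat.find_spec hend ⟨t, ht⟩
  · push Not at hend
    choose t ht hmin hm using fun i => hnext (J i) (hend i)
    have hm' : ∀ i, (J (i + 1)).1 ∈ applyTrigger (J i).1 (t i).1.1 (assignment (t i).2) :=
      fun i => by rw [hJs]; exact hm i
    have hmono : Monotone fun i => (J i).1 :=
      monotone_nat_of_le_succ fun i => subset_of_mem_applyTrigger (hm' i)
    have hinj : Function.Injective fun i => rank (t i) := by
      refine hrank.comp (Function.Injective.of_lt_imp_ne fun i j hij e => ?_)
      have hs := isSatisfied_of_mem_applyTrigger (ht i).1 (hm' i)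
      have ha := ht j
      rw [← e] at ha
      exact ha.2 (hs.mono (hmono hij))
    refine ⟨⊤, fun i => (J i).1, ⟨rfl, ?_, ?_⟩, fun i => (J i).2⟩
    · exact fun i _ => ⟨_, (t i).1.2, _, ht i, hm' i⟩
    · intro ρ hρ h i _ _
      by_contra! hcon
      obtain ⟨s, rfl, es, -⟩ := act_of ρ hρ h i (hcon i le_rfl le_top)
      have hle : ∀ j, rank (t (i + j)) ≤ rank s := fun j =>
        hmin _ _ ((hcon (i + j) (Nat.le_add_right _ _) le_top).congr es)
      have hinf := infinite_range_of_injective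
        (hinj.comp (add_right_injective i) : Function.Injective fun j => rank (t (i + j)))
      exact hinf ((finite_Iic (rank s)).subset (by rintro _ ⟨j, rfl⟩; exact hle j))

theorem exists_mem_chase_of_holds {I : Instance} (hI : Guided c₀ S I) {𝓡 : Set Rule}
    (h𝓡 : ∀ ρ ∈ 𝓡, ρ.Holds c₀ S) (hS : Atom.contr ∉ S) :
    ∃ C ∈ chase I 𝓡, Atom.contr ∉ C := by
  obtain ⟨N, J, hJ, hg⟩ := exists_guided_derivation hI h𝓡
  refine ⟨_, ⟨N, J, hJ, rfl⟩, ?_⟩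
  rintro ⟨i, -, hi⟩
  obtain ⟨-, g, -, hgi⟩ := hg i
  exact hS (hgi _ hi)

end Guided

/-! ### The chase and satisfiability -/

theorem headVertex_end {k n : ℕ} (hn : 0 < n) : headVertex k n n = k := by
  simp [headVertex, hn.ne']

/-- The atoms over the worlds of a Kripke model that are true in it. -/
def Kripke.trueAtoms {W : Type} (M : Kripke W) : Set (Atom W) :=
  {A | match A with
    | .contr => False
    | .P ψ w => Sat M ψ w
    | .bin _ w v => M.R w v}

/-! ### The rules are true in quasi-dense Kripke models -/

section Holds

variable {W : Type} {M : Kripke W} (c₀ : Const → W)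

theorem andRule_holds (ψ χ : ModalFormula) : (andRule ψ χ).Holds c₀ M.trueAtoms := by
  intro g hg
  have h : Sat M (.and ψ χ) (g 0) := hg (atomP (.and ψ χ) 0) (by simp [andRule])
  refine ⟨_, List.mem_singleton.2 rfl, g, fun _ _ => rfl, fun A hA => ?_⟩
  rcases (by simpa using hA : A = atomP ψ 0 ∨ A = atomP χ 0) with rfl | rfl
  · exact h.1
  · exact h.2

theorem orRule_holds (ψ χ : ModalFormula) : (orRule ψ χ).Holds c₀ M.trueAtoms := by
  intro g hg
  have h : Sat M (.or ψ χ) (g 0) := hg (atomP (.or ψ χ) 0) (by simp [orRule])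
  rcases h with h | h
  · refine ⟨{atomP ψ 0}, by simp [orRule], g, fun _ _ => rfl, fun A hA => ?_⟩
    rw [Finset.mem_singleton.1 hA]
    exact h
  · refine ⟨{atomP χ 0}, by simp [orRule], g, fun _ _ => rfl, fun A hA => ?_⟩
    rw [Finset.mem_singleton.1 hA]
    exact h

theorem boxRule_holds (ψ : ModalFormula) : (boxRule ψ).Holds c₀ M.trueAtoms := by
  intro g hg
  have h : Sat M (.box ψ) (g 0) := hg (atomP (.box ψ) 0) (by simp [boxRule])
  have hR : M.R (g 0) (g 1) := hg (atomR 0 1) (by simp [boxRule])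
  refine ⟨_, List.mem_singleton.2 rfl, g, fun _ _ => rfl, fun A hA => ?_⟩
  rw [Finset.mem_singleton.1 hA]
  exact h _ hR

theorem diaRule_holds (ψ : ModalFormula) : (diaRule ψ).Holds c₀ M.trueAtoms := by
  intro g hg
  obtain ⟨w, hR, hw⟩ : Sat M (.dia ψ) (g 0) := hg (atomP (.dia ψ) 0) (by simp [diaRule])
  refine ⟨_, List.mem_singleton.2 rfl, fun v => if v = 0 then g 0 else w, ?_, fun A hA => ?_⟩
  · rintro v ⟨A, hA, hv⟩
    rw [Finset.mem_singleton.1 hA] at hv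
    obtain rfl : v = 0 := by simpa [atomP, Atom.args] using hv
    simp
  · rcases (by simpa using hA : A = atomR 0 1 ∨ A = atomE 0 1 ∨ A = atomP ψ 1) with
      rfl | rfl | rfl
    · exact hR
    · exact hR
    · exact hw

theorem contrRule_holds (ψ : ModalFormula) : (contrRule ψ).Holds c₀ M.trueAtoms := by
  intro g hg
  have h : Sat M ψ (g 0) := hg (atomP ψ 0) (by simp [contrRule])
  have h' : Sat M ψ.neg (g 0) := hg (atomP ψ.neg 0) (by simp [contrRule])
  exact absurd h ((sat_neg M ψ _).1 h')

theorem qdpRule_holds {𝓟 : List QDP} (hM : QuasiDenseRel M.R 𝓟) {q : QDP} (hq : q ∈ 𝓟) :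
    (qdpRule q).Holds c₀ M.trueAtoms := by
  intro g hg
  obtain ⟨p, hp, hp0, hpn⟩ := hM q hq g fun i hi =>
    hg (atomR i (i + 1)) (Finset.mem_image.2 ⟨i, Finset.mem_range.2 hi, rfl⟩)
  obtain ⟨⟨k, n⟩, hk, hkn⟩ := q
  simp only at hp hp0 hpn hk hkn
  -- Variables up to `k` keep their values on the body path and variable `k + j` takes the `j`-th
  -- vertex of the longer path; the two agree at the shared endpoints.
  have hvert : ∀ j ≤ n, (fun v => if v ≤ k then g v else p (v - k)) (headVertex k n j) = p j := by
    intro j hj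
    by_cases h0 : j = 0
    · subst h0; simp [headVertex, hp0]
    by_cases hjn : j = n
    · subst hjn; simp [headVertex, h0, hpn]
    · have : ¬ k + j ≤ k := by omega
      simp [headVertex, h0, hjn]
  refine ⟨_, List.mem_singleton.2 rfl, fun v => if v ≤ k then g v else p (v - k), ?_, ?_⟩
  · rintro v ⟨A, hA, hv⟩
    obtain ⟨i, hi, rfl⟩ := Finset.mem_image.1 hA
    have hi := Finset.mem_range.1 hi
    have : v = i ∨ v = i + 1 := by simpa [atomR, Atom.args] using hv
    have hvk : v ≤ k := by
      rcases this with rfl | rfl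
      · exact hi.le
      · exact hi
    simp only [if_pos hvk]
  · intro A hA
    obtain ⟨j, hj, rfl⟩ := Finset.mem_image.1 hA
    have hj : j < n := Finset.mem_range.1 hj
    have := hp j hj
    rw [← hvert j hj.le, ← hvert (j + 1) hj] at this
    exact this

end Holds

theorem Satisfiable.exists_mem_chase {𝓟 : List QDP} {φ : ModalFormula} (h : Satisfiable 𝓟 φ)
    (a : Const) :
    ∃ C ∈ chase (database a φ) (modalRules φ ∪ qdpRules 𝓟), Atom.contr ∉ C := by
  obtain ⟨W, M, w, hM, hw⟩ := h
  refine exists_mem_chase_of_holds (c₀ := fun _ => w) (S := M.trueAtoms)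
    ⟨finite_singleton _, fun _ => w, fun _ => rfl, ?_⟩ ?_ id
  · rintro A rfl
    exact hw
  · rintro ρ ((⟨ψ, -, χ, -, rfl | rfl⟩ | ⟨ψ, -, rfl | rfl | rfl⟩) | ⟨q, hq, rfl⟩)
    · exact andRule_holds _ ψ χ
    · exact orRule_holds _ ψ χ
    · exact boxRule_holds _ ψ
    · exact diaRule_holds _ ψ
    · exact contrRule_holds _ ψ
    · exact qdpRule_holds _ hM hq

theorem ModalFormula.self_mem_subformulae (ψ : ModalFormula) : ψ ∈ ψ.subformulae := by
  cases ψ <;> simp [subformulae]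

/-- The Kripke model on the terms given by an instance. -/
def Instance.kripke (C : Instance) : Kripke Term where
  R t s := Atom.bin .R t s ∈ C
  V p t := Atom.P (.atom p) t ∈ C

/-! ### Kripke models from instances that satisfy the rules -/

section Truth

variable {C : Instance}

/-- Each rule of `R_φ` supplies the matching case of an induction on `ψ`. Absence of `contr` is
needed only for negated atoms, since the valuation is read off from the positive ones. -/
theorem sat_kripke_of_mem {φ : ModalFormula}
    (hC : ∀ ρ ∈ modalRules φ, ∀ h : Var → Term, IsTrigger ρ h C → IsSatisfied ρ h C)
    (hcontr : Atom.contr ∉ C) (ψ : ModalFormula) (hψ : ψ.subformulae ⊆ φ.subformulae) (t : Term)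
    (ht : Atom.P ψ t ∈ C) : Sat C.kripke ψ t := by
  induction ψ generalizing t with
  | atom p => exact ht
  | natom p =>
    intro hp
    obtain ⟨α, hα, h', -, -, hm⟩ := hC (contrRule (.natom p))
      (Or.inr ⟨_, hψ (ModalFormula.self_mem_subformulae _), Or.inr (Or.inr rfl)⟩) (fun _ => t)
      (by
        intro A hA
        rcases (by simpa [contrRule] using hA :
          A = atomP (.natom p) 0 ∨ A = atomP (ModalFormula.natom p).neg 0) with rfl | rfl
        · exact ht
        · exact hp)
    obtain rfl := List.mem_singleton.1 hα
    exact hcontr (hm Atom.contr (Finset.mem_singleton_self _))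
  | or ψ χ ihψ ihχ =>
    have sψ : ψ.subformulae ⊆ φ.subformulae := fun x hx => hψ (Or.inr (Or.inl hx))
    have sχ : χ.subformulae ⊆ φ.subformulae := fun x hx => hψ (Or.inr (Or.inr hx))
    obtain ⟨α, hα, h', e, -, hm⟩ := hC (orRule ψ χ)
      (Or.inl ⟨ψ, sψ ψ.self_mem_subformulae, χ, sχ χ.self_mem_subformulae, Or.inr rfl⟩)
      (fun _ => t) (fun A hA => by rw [Finset.mem_singleton.1 hA]; exact ht)
    have e0 : h' 0 = t := e ⟨_, Finset.mem_singleton_self _, rfl⟩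
    rcases (by simpa [orRule] using hα : α = {atomP ψ 0} ∨ α = {atomP χ 0}) with rfl | rfl
    · have := hm _ (Finset.mem_singleton_self _)
      exact Or.inl (ihψ sψ t (e0 ▸ this))
    · have := hm _ (Finset.mem_singleton_self _)
      exact Or.inr (ihχ sχ t (e0 ▸ this))
  | and ψ χ ihψ ihχ =>
    have sψ : ψ.subformulae ⊆ φ.subformulae := fun x hx => hψ (Or.inr (Or.inl hx))
    have sχ : χ.subformulae ⊆ φ.subformulae := fun x hx => hψ (Or.inr (Or.inr hx))
    obtain ⟨α, hα, h', e, -, hm⟩ := hC (andRule ψ χ)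
      (Or.inl ⟨ψ, sψ ψ.self_mem_subformulae, χ, sχ χ.self_mem_subformulae, Or.inl rfl⟩)
      (fun _ => t) (fun A hA => by rw [Finset.mem_singleton.1 hA]; exact ht)
    have e0 : h' 0 = t := e ⟨_, Finset.mem_singleton_self _, rfl⟩
    obtain rfl := List.mem_singleton.1 hα
    exact ⟨ihψ sψ t (e0 ▸ hm (atomP ψ 0) (by simp)), ihχ sχ t (e0 ▸ hm (atomP χ 0) (by simp))⟩
  | dia ψ ih =>
    have sψ : ψ.subformulae ⊆ φ.subformulae := fun x hx => hψ (Or.inr hx)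
    obtain ⟨α, hα, h', e, -, hm⟩ := hC (diaRule ψ)
      (Or.inr ⟨ψ, sψ ψ.self_mem_subformulae, Or.inr (Or.inl rfl)⟩)
      (fun _ => t) (fun A hA => by rw [Finset.mem_singleton.1 hA]; exact ht)
    have e0 : h' 0 = t := e ⟨_, Finset.mem_singleton_self _, rfl⟩
    obtain rfl := List.mem_singleton.1 hα
    exact ⟨h' 1, e0 ▸ hm (atomR 0 1) (by simp), ih sψ _ (hm (atomP ψ 1) (by simp))⟩
  | box ψ ih =>
    intro s hs
    have sψ : ψ.subformulae ⊆ φ.subformulae := fun x hx => hψ (Or.inr hx)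
    obtain ⟨α, hα, h', e, -, hm⟩ := hC (boxRule ψ)
      (Or.inr ⟨ψ, sψ ψ.self_mem_subformulae, Or.inl rfl⟩)
      (fun v => if v = 0 then t else s) (by
        intro A hA
        rcases (by simpa [boxRule] using hA : A = atomP (.box ψ) 0 ∨ A = atomR 0 1) with rfl | rfl
        · exact ht
        · exact hs)
    have e1 : h' 1 = s := e ⟨atomR 0 1, by simp [boxRule], Or.inr rfl⟩
    obtain rfl := List.mem_singleton.1 hα
    exact ih sψ _ (e1 ▸ hm (atomP ψ 1) (by simp))

theorem quasiDenseRel_kripke {𝓟 : List QDP}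
    (hC : ∀ ρ ∈ qdpRules 𝓟, ∀ h : Var → Term, IsTrigger ρ h C → IsSatisfied ρ h C) :
    QuasiDenseRel C.kripke.R 𝓟 := by
  intro q hq p hp
  obtain ⟨α, hα, h', e, -, hm⟩ := hC (qdpRule q) ⟨q, hq, rfl⟩ p (by
    intro A hA
    obtain ⟨i, hi, rfl⟩ := Finset.mem_image.1 hA
    exact hp i (Finset.mem_range.1 hi))
  obtain rfl := List.mem_singleton.1 hα
  obtain ⟨⟨k, n⟩, hk, hkn⟩ := q
  refine ⟨fun j => h' (headVertex k n j), fun j hj => ?_, ?_, ?_⟩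
  · exact hm (atomR (headVertex k n j) (headVertex k n (j + 1)))
      (Finset.mem_image.2 ⟨j, Finset.mem_range.2 hj, rfl⟩)
  · exact e ⟨atomR 0 1, Finset.mem_image.2 ⟨0, Finset.mem_range.2 hk, rfl⟩, Or.inl rfl⟩
  · simp only [headVertex_end (hk.trans hkn)]
    refine e ⟨atomR (k - 1) (k - 1 + 1),
      Finset.mem_image.2 ⟨k - 1, Finset.mem_range.2 (Nat.sub_lt hk one_pos), rfl⟩, Or.inr ?_⟩
    simp only at hk
    rw [mem_singleton_iff, Nat.sub_add_cancel hk]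

end Truth

theorem satisfiable_of_mem_chase {𝓟 : List QDP} {φ : ModalFormula} {a : Const} {C : Instance}
    (hC : C ∈ chase (database a φ) (modalRules φ ∪ qdpRules 𝓟)) (hcontr : Atom.contr ∉ C) :
    Satisfiable 𝓟 φ :=
  ⟨Term, C.kripke, Term.const a,
    quasiDenseRel_kripke fun _ hρ _ => isSatisfied_of_mem_chase hC (Or.inr hρ),
    sat_kripke_of_mem (fun _ hρ _ => isSatisfied_of_mem_chase hC (Or.inl hρ)) hcontr φ
      Subset.rfl _ (subset_of_mem_chase hC rfl)⟩

theorem exists_mem_chase_iff {𝓟 : List QDP} {φ : ModalFormula} {a : Const} :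
    (∃ C ∈ chase (database a φ) (modalRules φ ∪ qdpRules 𝓟), Atom.contr ∉ C) ↔
      Satisfiable 𝓟 φ :=
  ⟨fun ⟨_, hC, hc⟩ => satisfiable_of_mem_chase hC hc, fun h => h.exists_mem_chase a⟩

/-! ### Digits -/

/-- The `i`-th digit of `c` in base `b`. -/
def digit (b c i : ℕ) : ℕ := c / b ^ i % b

theorem digit_lt {b : ℕ} (hb : 0 < b) (c i : ℕ) : digit b c i < b := Nat.mod_lt _ hb

theorem exists_digits {b : ℕ} (m : ℕ) (f : ℕ → ℕ) (hf : ∀ i < m, f i < b) :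
    ∃ c < b ^ m, ∀ i < m, digit b c i = f i := by
  induction m generalizing f with
  | zero => exact ⟨0, by simp, by simp⟩
  | succ m ih =>
    obtain ⟨c, hc, h⟩ := ih (fun i => f (i + 1)) fun i hi => hf _ (Nat.succ_lt_succ hi)
    have h0 : f 0 < b := hf 0 (Nat.succ_pos m)
    have hb : 0 < b := lt_of_le_of_lt (Nat.zero_le _) h0
    refine ⟨f 0 + b * c, ?_, ?_⟩
    · calc f 0 + b * c < b + b * c := by omega
        _ = b * (c + 1) := by ring
        _ ≤ b * b ^ m := Nat.mul_le_mul_left _ hc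
        _ = b ^ (m + 1) := by ring
    · rintro (_ | i) hi
      · simp [digit, Nat.add_mul_mod_self_left, Nat.mod_eq_of_lt h0]
      · rw [← h i (Nat.lt_of_succ_lt_succ hi), digit, digit, pow_succ', ← Nat.div_div_eq_div_mul,
          Nat.add_mul_div_left _ _ hb, Nat.div_eq_of_lt h0, zero_add]

/-- The `i`-th binary digit of `c` is `1`. -/
def Bit (c i : ℕ) : Prop := digit 2 c i = 1

theorem exists_bits (m : ℕ) (s : Set ℕ) : ∃ c < 2 ^ m, ∀ i < m, Bit c i ↔ i ∈ s := by
  classical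
  obtain ⟨c, hc, h⟩ := exists_digits (b := 2) m (fun i => if i ∈ s then 1 else 0)
    fun i _ => by split_ifs <;> simp
  refine ⟨c, hc, fun i hi => ?_⟩
  rw [Bit, h i hi]
  by_cases his : i ∈ s <;> simp [his]

/-- A number whose first `m` binary digits give the set `s`. -/
noncomputable def setCode (m : ℕ) (s : Set ℕ) : ℕ := (exists_bits m s).choose

theorem setCode_lt (m : ℕ) (s : Set ℕ) : setCode m s < 2 ^ m := (exists_bits m s).choose_spec.1

theorem mem_of_setCode_eq {m : ℕ} {s t : Set ℕ} (h : setCode m s = setCode m t) {i : ℕ}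
    (hi : i < m) (his : i ∈ s) : i ∈ t := by
  have hs := (exists_bits m s).choose_spec.2 i hi
  have ht := (exists_bits m t).choose_spec.2 i hi
  change Bit (setCode m s) i ↔ i ∈ s at hs
  change Bit (setCode m t) i ↔ i ∈ t at ht
  rw [← ht, ← h, hs]
  exact his

theorem pair_lt_sq {x y N : ℕ} (hx : x < N) (hy : y < N) : Nat.pair x y < N ^ 2 :=
  (Nat.pair_lt_max_add_one_sq x y).trans_le (Nat.pow_le_pow_left (max_lt hx hy) 2)

/-! ### Modal degree -/

namespace ModalFormula

/-- The nesting depth of modal operators. -/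
def degree : ModalFormula → ℕ
  | atom _ => 0
  | natom _ => 0
  | or ψ χ => max ψ.degree χ.degree
  | and ψ χ => max ψ.degree χ.degree
  | dia ψ => ψ.degree + 1
  | box ψ => ψ.degree + 1

theorem degree_le_toNat (ψ : ModalFormula) : ψ.degree ≤ ψ.toNat := by
  induction ψ with
  | atom p => simp [degree]
  | natom p => simp [degree]
  | or ψ χ ihψ ihχ =>
    have h1 := Nat.left_le_pair ψ.toNat χ.toNat
    have h2 := Nat.right_le_pair ψ.toNat χ.toNat
    simp only [degree, toNat]; omega
  | and ψ χ ihψ ihχ =>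
    have h1 := Nat.left_le_pair ψ.toNat χ.toNat
    have h2 := Nat.right_le_pair ψ.toNat χ.toNat
    simp only [degree, toNat]; omega
  | dia ψ ih => simp only [degree, toNat]; omega
  | box ψ ih => simp only [degree, toNat]; omega

end ModalFormula

/-! ### Bisimilarity classes of bounded depth -/

/-- A bound for the codes of the classes of `m`-bisimilarity over `A` propositional atoms. -/
def tower (A : ℕ) : ℕ → ℕ
  | 0 => 2 ^ A
  | m + 1 => 2 ^ (A + tower A m)

theorem tower_mono (A : ℕ) : Monotone (tower A) :=
  monotone_nat_of_le_succ fun _ =>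
    (Nat.lt_two_pow_self).le.trans (Nat.pow_le_pow_right two_pos (Nat.le_add_left _ _))

theorem lt_tower (A m : ℕ) : A < tower A m :=
  Nat.lt_two_pow_self.trans_le (tower_mono A (Nat.zero_le m))

section Classes

variable {W : Type} (M : Kripke W) (A : ℕ)

/-- A code of the class of a world under `m`-bisimilarity over the atoms below `A`. -/
noncomputable def cls : ℕ → W → ℕ
  | 0, x => setCode A {p | p < A ∧ M.V p x}
  | m + 1, x => setCode (A + tower A m)
      {c | (c < A ∧ M.V c x) ∨ ∃ y, M.R x y ∧ c = A + cls m y}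

variable {M A}

theorem cls_lt (m : ℕ) (x : W) : cls M A m x < tower A m := by
  cases m <;> exact setCode_lt _ _

theorem val_of_cls_eq {m : ℕ} {x y : W} (h : cls M A m x = cls M A m y) {p : ℕ} (hp : p < A)
    (hx : M.V p x) : M.V p y := by
  cases m with
  | zero => exact (mem_of_setCode_eq h hp ⟨hp, hx⟩).2
  | succ m =>
    rcases mem_of_setCode_eq h (hp.trans_le (Nat.le_add_right _ _)) (Or.inl ⟨hp, hx⟩) with
      h | ⟨z, -, hz⟩
    · exact h.2
    · omega

theorem exists_rel_of_cls_eq {m : ℕ} {x y : W} (h : cls M A (m + 1) x = cls M A (m + 1) y) {x' : W}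
    (hx : M.R x x') : ∃ y', M.R y y' ∧ cls M A m x' = cls M A m y' := by
  rcases mem_of_setCode_eq h (Nat.add_lt_add_left (cls_lt m x') A) (Or.inr ⟨x', hx, rfl⟩) with
    h | ⟨z, hz, e⟩
  · omega
  · exact ⟨z, hz, Nat.add_left_cancel e⟩

/-- Finer classes refine coarser ones: agreement of successors at depth `m + 1` gives agreement at
depth `m` by induction, so the coded sets coincide. -/
theorem cls_eq_of_succ {m : ℕ} {x y : W} (h : cls M A (m + 1) x = cls M A (m + 1) y) :
    cls M A m x = cls M A m y := by
  induction m generalizing x y with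
  | zero =>
    have : {p | p < A ∧ M.V p x} = {p | p < A ∧ M.V p y} := by
      ext p
      exact and_congr_right fun hp => ⟨val_of_cls_eq h hp, val_of_cls_eq h.symm hp⟩
    rw [cls, cls, this]
  | succ m ih =>
    have key : ∀ {x y : W}, cls M A (m + 1 + 1) x = cls M A (m + 1 + 1) y →
        {c | (c < A ∧ M.V c x) ∨ ∃ z, M.R x z ∧ c = A + cls M A m z} ⊆
        {c | (c < A ∧ M.V c y) ∨ ∃ z, M.R y z ∧ c = A + cls M A m z} := by
      rintro x y h c (⟨hc, hx⟩ | ⟨z, hz, rfl⟩)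
      · exact Or.inl ⟨hc, val_of_cls_eq h hc hx⟩
      · obtain ⟨z', hz', e⟩ := exists_rel_of_cls_eq h hz
        exact Or.inr ⟨z', hz', by rw [ih e]⟩
    rw [cls, cls, (key h).antisymm (key h.symm)]

theorem cls_eq_of_le {m m' : ℕ} (hm : m' ≤ m) {x y : W} (h : cls M A m x = cls M A m y) :
    cls M A m' x = cls M A m' y := by
  induction m, hm using Nat.le_induction with
  | base => exact h
  | succ m _ ih => exact ih (cls_eq_of_succ h)

/-- Each modal operator spends one unit of depth. The bound on the code also bounds every
propositional atom in `ψ`, so the classes see all of them. -/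
theorem sat_of_cls_eq {m : ℕ} {x y : W} (h : cls M A m x = cls M A m y) {ψ : ModalFormula}
    (hd : ψ.degree ≤ m) (hA : ψ.toNat < A) (hx : Sat M ψ x) : Sat M ψ y := by
  induction ψ generalizing m x y with
  | atom p => exact val_of_cls_eq h (by simp only [ModalFormula.toNat] at hA; omega) hx
  | natom p =>
    exact fun hy => hx (val_of_cls_eq h.symm (by simp only [ModalFormula.toNat] at hA; omega) hy)
  | or ψ χ ihψ ihχ =>
    have h1 := Nat.left_le_pair ψ.toNat χ.toNat
    have h2 := Nat.right_le_pair ψ.toNat χ.toNat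
    simp only [ModalFormula.toNat, ModalFormula.degree, max_le_iff] at hA hd
    exact hx.imp (ihψ h hd.1 (by omega)) (ihχ h hd.2 (by omega))
  | and ψ χ ihψ ihχ =>
    have h1 := Nat.left_le_pair ψ.toNat χ.toNat
    have h2 := Nat.right_le_pair ψ.toNat χ.toNat
    simp only [ModalFormula.toNat, ModalFormula.degree, max_le_iff] at hA hd
    exact hx.imp (ihψ h hd.1 (by omega)) (ihχ h hd.2 (by omega))
  | dia ψ ih =>
    simp only [ModalFormula.toNat, ModalFormula.degree] at hA hd
    obtain ⟨m, rfl⟩ := Nat.exists_eq_add_of_le' (Nat.le_of_add_left_le hd)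
    obtain ⟨x', hx', hs⟩ := hx
    obtain ⟨y', hy', e⟩ := exists_rel_of_cls_eq h hx'
    exact ⟨y', hy', ih e (by omega) (by omega) hs⟩
  | box ψ ih =>
    simp only [ModalFormula.toNat, ModalFormula.degree] at hA hd
    obtain ⟨m, rfl⟩ := Nat.exists_eq_add_of_le' (Nat.le_of_add_left_le hd)
    intro y' hy'
    obtain ⟨x', hx', e⟩ := exists_rel_of_cls_eq h.symm hy'
    exact ih e.symm (by omega) (by omega) (hx x' hx')

/-! ### The levelled quotient -/

variable (M A) (d : ℕ)

/-- The code of the node of level `i` given by the world `x`. -/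
noncomputable def node (i : ℕ) (x : W) : ℕ := Nat.pair i (cls M A (d - i) x)

/-- The accessibility relation between nodes. -/
def Edge (u v : ℕ) : Prop :=
  ∃ i ≤ d, ∃ x, ∃ j ≤ d, ∃ y, u = node M A d i x ∧ v = node M A d j y ∧ j ≤ i + 1 ∧
    (i < d → ∃ y', M.R x y' ∧ cls M A (d - i - 1) y' = cls M A (d - i - 1) y)

/-- The formula with code `f` belongs to the node `u`. -/
def Label (u f : ℕ) : Prop :=
  ∃ i ≤ d, ∃ x, u = node M A d i x ∧ ∃ ψ : ModalFormula, f = ψ.toNat ∧ f < A ∧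
    ψ.degree + i ≤ d ∧ Sat M ψ x

variable {M A d}

theorem node_eq_iff {i j : ℕ} {x y : W} :
    node M A d i x = node M A d j y ↔ i = j ∧ cls M A (d - i) x = cls M A (d - i) y := by
  rw [node, node, Nat.pair_eq_pair]
  constructor <;> rintro ⟨rfl, h⟩ <;> exact ⟨rfl, h⟩

theorem node_lt {i : ℕ} (hi : i ≤ d) (hd : d ≤ A) (x : W) :
    node M A d i x < tower A d ^ 2 :=
  pair_lt_sq ((hi.trans hd).trans_lt (lt_tower A d))
    ((cls_lt _ _).trans_le (tower_mono A (Nat.sub_le d i)))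

/-- Edges do not depend on representatives: the source class knows its successors to depth `d - i -
1`, and `j ≤ i + 1` makes the target class at least that fine. -/
theorem edge_node_iff {i j : ℕ} (hi : i ≤ d) (hj : j ≤ d) {x y : W} :
    Edge M A d (node M A d i x) (node M A d j y) ↔
      j ≤ i + 1 ∧ (i < d → ∃ y', M.R x y' ∧ cls M A (d - i - 1) y' = cls M A (d - i - 1) y) := by
  constructor
  · rintro ⟨i', -, x₁, j', -, y₁, hu, hv, hji, hR⟩
    obtain ⟨rfl, hx⟩ := node_eq_iff.1 hu
    obtain ⟨rfl, hy⟩ := node_eq_iff.1 hv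
    refine ⟨hji, fun hid => ?_⟩
    obtain ⟨y', hy', e⟩ := hR hid
    obtain ⟨m, hm⟩ : ∃ m, d - i = m + 1 := ⟨d - i - 1, by omega⟩
    rw [hm] at hx
    have hm' : d - i - 1 = m := by omega
    rw [hm'] at e ⊢
    obtain ⟨y'', hy'', e'⟩ := exists_rel_of_cls_eq hx.symm hy'
    exact ⟨y'', hy'', e'.symm.trans (e.trans (cls_eq_of_le (by omega) hy).symm)⟩
  · rintro ⟨hji, hR⟩
    exact ⟨i, hi, x, j, hj, y, rfl, rfl, hji, hR⟩

/-- Levels rise by at most one per step, so the edge out of step `m` is accurate at least to depth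
`d - i 0 - m - 1`, which is exactly the precision claimed for step `m + 1`. -/
theorem exists_lift_walk {k : ℕ} {i : ℕ → ℕ} {x : ℕ → W}
    (hi : ∀ m < k, i (m + 1) ≤ i m + 1)
    (hx : ∀ m < k, i m < d → ∃ y', M.R (x m) y' ∧
      cls M A (d - i m - 1) y' = cls M A (d - i m - 1) (x (m + 1)))
    (m : ℕ) (hmk : m ≤ k) (hmd : i 0 + m ≤ d) :
    i m ≤ i 0 + m ∧ ∃ z : ℕ → W, z 0 = x 0 ∧ Walk M.R m z ∧
      cls M A (d - i 0 - m) (z m) = cls M A (d - i 0 - m) (x m) := by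
  induction m with
  | zero => exact ⟨le_rfl, fun _ => x 0, rfl, fun _ h => absurd h (Nat.not_lt_zero _), rfl⟩
  | succ m ih =>
    obtain ⟨him, z, hz0, hz, hzm⟩ := ih (by omega) (by omega)
    have hm := hi m (by omega)
    refine ⟨by omega, ?_⟩
    obtain ⟨y', hy', e⟩ := hx m (by omega) (by omega)
    obtain ⟨s, hs⟩ : ∃ s, d - i 0 - m = s + 1 := ⟨d - i 0 - m - 1, by omega⟩
    have hs' : d - i 0 - (m + 1) = s := by omega
    rw [hs] at hzm
    obtain ⟨z', hz', e'⟩ := exists_rel_of_cls_eq hzm.symm hy'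
    refine ⟨fun j => if j ≤ m then z j else z', by simp [hz0], fun j hj => ?_, ?_⟩
    · by_cases hjm : j < m
      · simp only [if_pos hjm.le, if_pos (Nat.succ_le_of_lt hjm)]
        exact hz j hjm
      · obtain rfl : j = m := by omega
        simpa using hz'
    · rw [hs']
      simp only [Nat.not_succ_le_self, if_false]
      exact e'.symm.trans (cls_eq_of_le (by omega) e)

theorem quasiDenseRel_edge {𝓟 : List QDP} (hM : QuasiDenseRel M.R 𝓟) :
    QuasiDenseRel (Edge M A d) 𝓟 := by
  rintro q hq p hp
  have hMq := hM q hq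
  obtain ⟨⟨k, n⟩, hk, hkn⟩ := q
  simp only at hk hkn hMq hp ⊢
  have hnode : ∀ m, ∃ i x, m ≤ k → i ≤ d ∧ p m = node M A d i x := by
    intro m
    by_cases hm : m < k
    · obtain ⟨i, hi, x, -, -, -, e, -⟩ := hp m hm
      exact ⟨i, x, fun _ => ⟨hi, e⟩⟩
    · obtain ⟨-, -, -, j, hj, y, -, e, -⟩ := hp (k - 1) (by omega)
      refine ⟨j, y, fun hmk => ⟨hj, ?_⟩⟩
      rw [← e, Nat.sub_add_cancel hk, le_antisymm hmk (not_lt.1 hm)]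
  choose i x hix using hnode
  have hedge : ∀ m < k, i (m + 1) ≤ i m + 1 ∧ (i m < d → ∃ y', M.R (x m) y' ∧
      cls M A (d - i m - 1) y' = cls M A (d - i m - 1) (x (m + 1))) := by
    intro m hm
    rw [← edge_node_iff (hix m hm.le).1 (hix (m + 1) hm).1, ← (hix m hm.le).2,
      ← (hix (m + 1) hm).2]
    exact hp m hm
  have hlift := exists_lift_walk (A := A) (fun m hm => (hedge m hm).1) fun m hm => (hedge m hm).2
  have hi0 : i 0 ≤ d := (hix 0 (Nat.zero_le k)).1
  have hik : i k ≤ i 0 + k := by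
    have : ∀ m ≤ k, i m ≤ i 0 + m := by
      intro m
      induction m with
      | zero => exact fun _ => le_rfl
      | succ m ih =>
        intro hm
        have h1 := ih (by omega)
        have h2 := (hedge m (by omega)).1
        omega
    exact this k le_rfl
  -- From level `d` on, edges restrict only levels, so `v` has to follow `M.R` only below that
  -- level, and its end has to match `x k` only if level `d` is not passed. If already `i 0 + k >
  -- d`, lifting an initial part of the walk suffices and quasi-density of `M` is not used.
  obtain ⟨v, hv0, hv, hvn⟩ : ∃ v : ℕ → W, v 0 = x 0 ∧
      (∀ j < n, i 0 + j < d → M.R (v j) (v (j + 1))) ∧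
      (i 0 + n ≤ d → cls M A (d - i 0 - n) (v n) = cls M A (d - i 0 - n) (x k)) := by
    by_cases hkd : i 0 + k ≤ d
    · obtain ⟨-, z, hz0, hz, hzk⟩ := hlift k le_rfl hkd
      obtain ⟨v, hv, hv0, hvn⟩ := hMq z hz
      refine ⟨v, hv0.trans hz0, fun j hj _ => hv j hj, fun _ => ?_⟩
      rw [hvn]
      exact cls_eq_of_le (by omega) hzk
    · obtain ⟨-, z, hz0, hz, -⟩ := hlift (d - i 0) (by omega) (by omega)
      exact ⟨z, hz0, fun j _ hj => hz j (by omega), fun h => by omega⟩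
  -- Levels climb by one up to the cap `d`. The last vertex is `p k` itself, whose level may be
  -- lower than that of its predecessor; this is why edges may go back to lower levels.
  refine ⟨fun j => if j < n then node M A d (min (i 0 + j) d) (v j) else p k, fun j hj => ?_, ?_,
    by simp⟩
  · by_cases hjn : j + 1 < n
    · simp only [if_pos hj, if_pos hjn]
      refine (edge_node_iff (min_le_right _ _) (min_le_right _ _)).2 ⟨by omega, fun h => ?_⟩
      exact ⟨_, hv j hj (by omega), rfl⟩
    · simp only [if_pos hj, if_neg hjn]
      rw [(hix k le_rfl).2]
      have hdk := (hix k le_rfl).1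
      refine (edge_node_iff (min_le_right _ _) hdk).2 ⟨by omega, fun h => ?_⟩
      obtain rfl : n = j + 1 := by omega
      refine ⟨_, hv j hj (by omega), ?_⟩
      have : d - min (i 0 + j) d - 1 = d - i 0 - (j + 1) := by omega
      rw [this]
      exact hvn (by omega)
  · simp only [if_pos (hk.trans hkn), add_zero, min_eq_left hi0, hv0]
    exact (hix 0 (Nat.zero_le k)).2.symm

end Classes

/-! ### Certificates -/

/-- The number `f` as the code of a formula belonging to `x` is respected. -/
def LocallyTrue (N r l x f : ℕ) : Prop :=
  (f % 6 = 1 → ¬ Bit l (Nat.pair x (f - 1))) ∧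
  (f % 6 = 2 → Bit l (Nat.pair x (f / 6).unpair.1) ∨ Bit l (Nat.pair x (f / 6).unpair.2)) ∧
  (f % 6 = 3 → Bit l (Nat.pair x (f / 6).unpair.1) ∧ Bit l (Nat.pair x (f / 6).unpair.2)) ∧
  (f % 6 = 4 → ∃ y < N, Bit r (Nat.pair x y) ∧ Bit l (Nat.pair y (f / 6))) ∧
  (f % 6 = 5 → ∀ y < N, Bit r (Nat.pair x y) → Bit l (Nat.pair y (f / 6)))

/-- The first `k` steps of the sequence of the digits of `p` in base `N` follow the relation
coded by `r`. -/
def CodedWalk (N r k p : ℕ) : Prop :=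
  ∀ i < k, Bit r (Nat.pair (digit N p i) (digit N p (i + 1)))

/-- The relation coded by `r` on the numbers below `N` has the quasi-density property `q`. -/
def CodedQuasiDense (N r : ℕ) (q : QDP) : Prop :=
  ∀ p < N ^ (q.1.1 + 1), CodedWalk N r q.1.1 p →
    ∃ p' < N ^ (q.1.2 + 1), CodedWalk N r q.1.2 p' ∧ digit N p' 0 = digit N p 0 ∧
      digit N p' q.1.2 = digit N p q.1.1

/-- The numbers `r` and `l` code the accessibility relation and the labelling with formulae of a
model of the formula with code `e` on the numbers below `N`. -/
def IsCertificate (𝓟 : List QDP) (e N r l : ℕ) : Prop :=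
  (∃ x < N, Bit l (Nat.pair x e)) ∧
  (∀ x < N, ∀ f < N, Bit l (Nat.pair x f) → LocallyTrue N r l x f) ∧
  ∀ q ∈ 𝓟, CodedQuasiDense N r q

/-- The Kripke model coded by `r` and `l`. -/
def codedKripke (N r l : ℕ) : Kripke ℕ where
  R x y := x < N ∧ y < N ∧ Bit r (Nat.pair x y)
  V p x := Bit l (Nat.pair x (6 * p))

theorem IsCertificate.satisfiable {𝓟 : List QDP} {φ : ModalFormula} {N r l : ℕ}
    (h : IsCertificate 𝓟 φ.toNat N r l) (hN : φ.toNat < N) : Satisfiable 𝓟 φ := by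
  obtain ⟨⟨x, hx, hxφ⟩, hl, hr⟩ := h
  have hN0 : 0 < N := by omega
  refine ⟨ℕ, codedKripke N r l, x, ?_, ?_⟩
  · intro q hq p hp
    have hk := q.2.1
    have hpN : ∀ i < q.1.1 + 1, p i < N := by
      intro i hi
      by_cases hiq : i < q.1.1
      · exact (hp i hiq).1
      · obtain rfl : i = q.1.1 := by omega
        have := (hp (q.1.1 - 1) (by omega)).2.1
        rwa [Nat.sub_add_cancel hk] at this
    obtain ⟨c, hc, hcp⟩ := exists_digits (q.1.1 + 1) p hpN
    obtain ⟨c', -, hw, h0, hn⟩ := hr q hq c hc fun i hi => by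
      rw [hcp i (by omega), hcp (i + 1) (by omega)]
      exact (hp i hi).2.2
    refine ⟨digit N c', fun i hi => ⟨digit_lt hN0 _ _, digit_lt hN0 _ _, hw i hi⟩, ?_, ?_⟩
    · rw [h0, hcp 0 (by omega)]
    · rw [hn, hcp _ (by omega)]
  -- Local truth is checked only for codes below `N`; immediate subformulae have no larger codes, so
  -- the induction stays in this range.
  · have key : ∀ (ψ : ModalFormula) (x : ℕ), x < N → ψ.toNat < N → Bit l (Nat.pair x ψ.toNat) →
        Sat (codedKripke N r l) ψ x := by
      intro ψ
      induction ψ with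
      | atom p => exact fun x _ _ h => h
      | natom p =>
        intro x hx hψ h hp
        exact (hl x hx _ hψ h).1 (by simp only [ModalFormula.toNat]; omega) hp
      | or ψ χ ihψ ihχ =>
        intro x hx hψ h
        have h1 := Nat.left_le_pair ψ.toNat χ.toNat
        have h2 := Nat.right_le_pair ψ.toNat χ.toNat
        have hloc := (hl x hx _ hψ h).2.1
        simp only [ModalFormula.toNat] at hψ hloc
        have e : (6 * Nat.pair ψ.toNat χ.toNat + 2) / 6 = Nat.pair ψ.toNat χ.toNat := by omega
        rw [e, Nat.unpair_pair] at hloc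
        exact (hloc (by omega)).imp (ihψ x hx (by omega)) (ihχ x hx (by omega))
      | and ψ χ ihψ ihχ =>
        intro x hx hψ h
        have h1 := Nat.left_le_pair ψ.toNat χ.toNat
        have h2 := Nat.right_le_pair ψ.toNat χ.toNat
        have hloc := (hl x hx _ hψ h).2.2.1
        simp only [ModalFormula.toNat] at hψ hloc
        have e : (6 * Nat.pair ψ.toNat χ.toNat + 3) / 6 = Nat.pair ψ.toNat χ.toNat := by omega
        rw [e, Nat.unpair_pair] at hloc
        exact (hloc (by omega)).imp (ihψ x hx (by omega)) (ihχ x hx (by omega))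
      | dia ψ ih =>
        intro x hx hψ h
        have hloc := (hl x hx _ hψ h).2.2.2.1
        simp only [ModalFormula.toNat] at hψ hloc
        obtain ⟨y, hy, hxy, hyψ⟩ := hloc (by omega)
        have e : (6 * ψ.toNat + 4) / 6 = ψ.toNat := by omega
        rw [e] at hyψ
        exact ⟨y, ⟨hx, hy, hxy⟩, ih y hy (by omega) hyψ⟩
      | box ψ ih =>
        intro x hx hψ h y hy
        have hloc := (hl x hx _ hψ h).2.2.2.2
        simp only [ModalFormula.toNat] at hψ hloc
        have e : (6 * ψ.toNat + 5) / 6 = ψ.toNat := by omega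
        rw [e] at hloc
        exact ih y hy.2.1 (by omega) (hloc (by omega) y hy.2.1 hy.2.2)
    exact key φ x hx hN hxφ

/-- A bound for the worlds of the models of the formula with code `e`. -/
def worldBound (e : ℕ) : ℕ := tower (e + 1) (e + 1) ^ 2

theorem lt_worldBound (e : ℕ) : e + 1 < worldBound e :=
  (lt_tower (e + 1) (e + 1)).trans_le (Nat.le_self_pow two_ne_zero _)

/-- The certificate is the levelled quotient with depth `d = A = φ.toNat + 1`, which exceeds the
degree of `φ`. Numbers that are not nodes have no edges and no labels. -/
theorem Satisfiable.exists_isCertificate {𝓟 : List QDP} {φ : ModalFormula}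
    (h : Satisfiable 𝓟 φ) :
    ∃ r < 2 ^ worldBound φ.toNat ^ 2, ∃ l < 2 ^ worldBound φ.toNat ^ 2,
      IsCertificate 𝓟 φ.toNat (worldBound φ.toNat) r l := by
  obtain ⟨W, M, w, hM, hw⟩ := h
  set A := φ.toNat + 1 with hA
  have hN0 : A < worldBound φ.toNat := lt_worldBound _
  have hnode : ∀ i ≤ A, ∀ x, node M A A i x < worldBound φ.toNat :=
    fun i hi x => node_lt hi le_rfl x
  generalize worldBound φ.toNat = N at *
  obtain ⟨r, hr, hrbit⟩ := exists_bits (N ^ 2) {c | Edge M A A c.unpair.1 c.unpair.2}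
  obtain ⟨l, hl, hlbit⟩ := exists_bits (N ^ 2) {c | Label M A A c.unpair.1 c.unpair.2}
  have hR : ∀ x < N, ∀ y < N, (Bit r (Nat.pair x y) ↔ Edge M A A x y) := fun x hx y hy => by
    simpa using hrbit _ (pair_lt_sq hx hy)
  have hL : ∀ x < N, ∀ y < N, (Bit l (Nat.pair x y) ↔ Label M A A x y) := fun x hx y hy => by
    simpa using hlbit _ (pair_lt_sq hx hy)
  refine ⟨r, hr, l, hl, ⟨node M A A 0 w, hnode _ (Nat.zero_le _) _, ?_⟩, ?_, ?_⟩
  · rw [hL _ (hnode _ (Nat.zero_le _) _) _ (by omega)]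
    exact ⟨0, Nat.zero_le _, w, rfl, φ, rfl, by omega,
      φ.degree_le_toNat.trans (by omega), hw⟩
  · intro u hu f hf hb
    obtain ⟨i, hi, x, rfl, ψ, rfl, hψA, hdeg, hx⟩ := (hL u hu f hf).1 hb
    have lab : ∀ χ : ModalFormula, χ.toNat < A → χ.degree + i ≤ A → Sat M χ x →
        Bit l (Nat.pair (node M A A i x) χ.toNat) := fun χ h1 h2 h3 =>
      (hL _ hu _ (h1.trans hN0)).2 ⟨i, hi, x, rfl, χ, rfl, h1, h2, h3⟩
    cases ψ with
    | atom p =>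
      simp only [ModalFormula.toNat]
      refine ⟨?_, ?_, ?_, ?_, ?_⟩ <;> intro h <;> omega
    | natom p =>
      simp only [ModalFormula.toNat] at *
      refine ⟨fun _ => ?_, ?_, ?_, ?_, ?_⟩
      · rw [Nat.add_sub_cancel, hL _ hu _ (by omega)]
        -- A label may be witnessed by another representative `y` of the node, but the class fixes
        -- the valuation below `A`.
        rintro ⟨j, -, y, e, χ, hχ, -, -, hy⟩
        obtain ⟨-, e⟩ := node_eq_iff.1 e
        have : χ = .atom p := by
          apply ModalFormula.equivNat.injective
          change χ.toNat = ModalFormula.toNat (.atom p)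
          rw [← hχ]; rfl
        subst this
        exact hx (val_of_cls_eq e.symm (by omega) hy)
      all_goals intro h; omega
    | or ψ χ =>
      have h1 := Nat.left_le_pair ψ.toNat χ.toNat
      have h2 := Nat.right_le_pair ψ.toNat χ.toNat
      simp only [ModalFormula.toNat, ModalFormula.degree] at *
      have e : (6 * Nat.pair ψ.toNat χ.toNat + 2) / 6 = Nat.pair ψ.toNat χ.toNat := by omega
      refine ⟨?_, fun _ => ?_, ?_, ?_, ?_⟩
      · intro h; omega
      · rw [e, Nat.unpair_pair]
        exact hx.imp (lab ψ (by omega) (by omega)) (lab χ (by omega) (by omega))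
      all_goals intro h; omega
    | and ψ χ =>
      have h1 := Nat.left_le_pair ψ.toNat χ.toNat
      have h2 := Nat.right_le_pair ψ.toNat χ.toNat
      simp only [ModalFormula.toNat, ModalFormula.degree] at *
      have e : (6 * Nat.pair ψ.toNat χ.toNat + 3) / 6 = Nat.pair ψ.toNat χ.toNat := by omega
      refine ⟨?_, ?_, fun _ => ?_, ?_, ?_⟩
      · intro h; omega
      · intro h; omega
      · rw [e, Nat.unpair_pair]
        exact hx.imp (lab ψ (by omega) (by omega)) (lab χ (by omega) (by omega))
      all_goals intro h; omega
    | dia ψ =>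
      simp only [ModalFormula.toNat, ModalFormula.degree] at *
      have e : (6 * ψ.toNat + 4) / 6 = ψ.toNat := by omega
      refine ⟨?_, ?_, ?_, fun _ => ?_, ?_⟩
      · intro h; omega
      · intro h; omega
      · intro h; omega
      · rw [e]
        obtain ⟨y, hxy, hy⟩ := hx
        have hi' : i + 1 ≤ A := by omega
        refine ⟨node M A A (i + 1) y, hnode _ hi' y, ?_, ?_⟩
        · rw [hR _ hu _ (hnode _ hi' y)]
          exact (edge_node_iff hi hi').2 ⟨le_rfl, fun _ => ⟨y, hxy, rfl⟩⟩
        · rw [hL _ (hnode _ hi' y) _ (by omega)]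
          exact ⟨i + 1, hi', y, rfl, ψ, rfl, by omega, by omega, hy⟩
      · intro h; omega
    | box ψ =>
      simp only [ModalFormula.toNat, ModalFormula.degree] at *
      have e : (6 * ψ.toNat + 5) / 6 = ψ.toNat := by omega
      refine ⟨?_, ?_, ?_, ?_, fun _ v hv hRv => ?_⟩
      · intro h; omega
      · intro h; omega
      · intro h; omega
      · intro h; omega
      · rw [e]
        -- A label `□ψ` at level `i` forces `i < A`. The edge then gives a successor `y'` of `x`
        -- that agrees with `y` to depth `A - i - 1`, at least the degree of `ψ`, and `j ≤ i + 1`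
        -- leaves room for `ψ` at level `j`.
        have hE := (hR _ hu _ hv).1 hRv
        obtain ⟨-, -, -, j, hj, y, -, rfl, -⟩ := id hE
        obtain ⟨hji, hxy⟩ := (edge_node_iff hi hj).1 hE
        obtain ⟨y', hxy', ey⟩ := hxy (by omega)
        rw [hL _ hv _ (by omega)]
        exact ⟨j, hj, y, rfl, ψ, rfl, by omega, by omega,
          sat_of_cls_eq ey (by omega) (by omega) (hx y' hxy')⟩
  · intro q hq c hc hw
    have hN : 0 < N := by omega
    obtain ⟨p, hp, h0, hn⟩ := quasiDenseRel_edge (A := A) (d := A) hM q hq (digit N c)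
      fun i hi => (hR _ (digit_lt hN _ _) _ (digit_lt hN _ _)).1 (hw i hi)
    have hn0 : 0 < q.1.2 := q.2.1.trans q.2.2
    have hpN : ∀ i < q.1.2 + 1, p i < N := by
      intro i hi
      by_cases hiq : i < q.1.2
      · obtain ⟨j, hj, y, -, -, -, e, -⟩ := hp i hiq
        rw [e]
        exact hnode j hj y
      · obtain rfl : i = q.1.2 := by omega
        rw [hn]
        exact digit_lt hN _ _
    obtain ⟨c', hc', hd⟩ := exists_digits (q.1.2 + 1) p hpN
    refine ⟨c', hc', fun i hi => ?_, ?_, ?_⟩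
    · rw [hd i (by omega), hd (i + 1) (by omega),
        hR _ (hpN i (by omega)) _ (hpN (i + 1) (by omega))]
      exact hp i hi
    · rw [hd 0 (by omega), h0]
    · rw [hd _ (by omega), hn]

theorem satisfiable_iff {𝓟 : List QDP} {φ : ModalFormula} :
    Satisfiable 𝓟 φ ↔
      ∃ r < 2 ^ worldBound φ.toNat ^ 2, ∃ l < 2 ^ worldBound φ.toNat ^ 2,
        IsCertificate 𝓟 φ.toNat (worldBound φ.toNat) r l :=
  ⟨fun h => h.exists_isCertificate, fun ⟨_, _, _, _, h⟩ =>
    h.satisfiable ((Nat.lt_succ_self _).trans (lt_worldBound _))⟩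

/-! ### Primitive recursiveness of the search for certificates -/

section Primrec

variable {α : Type*} [Primcodable α]

theorem primrecPred_imp {p q : α → Prop} (hp : PrimrecPred p) (hq : PrimrecPred q) :
    PrimrecPred fun a => p a → q a :=
  (hp.not.or hq).of_eq fun _ => imp_iff_not_or.symm

theorem primrecPred_exists_lt {b : α → ℕ} {p : α → ℕ → Prop} (hb : Primrec b)
    (hp : PrimrecPred fun x : α × ℕ => p x.1 x.2) : PrimrecPred fun a => ∃ x < b a, p a x := by
  have h : PrimrecRel fun (x : ℕ) (a : α) => p a x := hp.comp (Primrec.pair Primrec.snd Primrec.fst)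
  exact (h.exists_mem_list.comp (Primrec.list_range.comp hb) Primrec.id).of_eq fun a => by simp

theorem primrecPred_forall_lt {b : α → ℕ} {p : α → ℕ → Prop} (hb : Primrec b)
    (hp : PrimrecPred fun x : α × ℕ => p x.1 x.2) : PrimrecPred fun a => ∀ x < b a, p a x := by
  have h : PrimrecRel fun (x : ℕ) (a : α) => p a x := hp.comp (Primrec.pair Primrec.snd Primrec.fst)
  exact (h.forall_mem_list.comp (Primrec.list_range.comp hb) Primrec.id).of_eq fun a => by simp

theorem primrec_pow {f g : α → ℕ} (hf : Primrec f) (hg : Primrec g) :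
    Primrec fun a => f a ^ g a :=
  (Primrec₂.unpaired'.1 Nat.Primrec.pow : Primrec₂ fun m n : ℕ => m ^ n).comp hf hg

theorem primrec_digit {b c i : α → ℕ} (hb : Primrec b) (hc : Primrec c) (hi : Primrec i) :
    Primrec fun a => digit (b a) (c a) (i a) :=
  Primrec.nat_mod.comp (Primrec.nat_div.comp hc (primrec_pow hb hi)) hb

theorem primrecPred_bit_pair {c x y : α → ℕ} (hc : Primrec c) (hx : Primrec x) (hy : Primrec y) :
    PrimrecPred fun a => Bit (c a) (Nat.pair (x a) (y a)) :=
  Primrec.eq.comp (primrec_digit (Primrec.const 2) hc (Primrec₂.natPair.comp hx hy))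
    (Primrec.const 1)

theorem primrec_tower {A m : α → ℕ} (hA : Primrec A) (hm : Primrec m) :
    Primrec fun a => tower (A a) (m a) := by
  have hs : Primrec fun p : α × ℕ × ℕ => 2 ^ (A p.1 + p.2.2) :=
    primrec_pow (Primrec.const 2) (Primrec.nat_add.comp (hA.comp Primrec.fst)
      (Primrec.snd.comp Primrec.snd))
  have h : Primrec fun a => Nat.rec (motive := fun _ => ℕ) (2 ^ A a)
      (fun _ t => 2 ^ (A a + t)) (m a) :=
    Primrec.nat_rec' hm (primrec_pow (Primrec.const 2) hA) hs.to₂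
  refine h.of_eq fun a => ?_
  induction m a with
  | zero => rfl
  | succ m ih => simp only [tower, ← ih]

theorem primrec_worldBound {e : α → ℕ} (he : Primrec e) : Primrec fun a => worldBound (e a) :=
  primrec_pow (primrec_tower (Primrec.succ.comp he) (Primrec.succ.comp he)) (Primrec.const 2)

theorem primrecPred_locallyTrue {N r l x f : α → ℕ} (hN : Primrec N) (hr : Primrec r)
    (hl : Primrec l) (hx : Primrec x) (hf : Primrec f) :
    PrimrecPred fun a => LocallyTrue (N a) (r a) (l a) (x a) (f a) := by
  have hmod (i : ℕ) : PrimrecPred fun a => f a % 6 = i :=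
    Primrec.eq.comp (Primrec.nat_mod.comp hf (Primrec.const 6)) (Primrec.const i)
  have hdiv : Primrec fun a => f a / 6 := Primrec.nat_div.comp hf (Primrec.const 6)
  have h1 := Primrec.fst.comp (Primrec.unpair.comp hdiv)
  have h2 := Primrec.snd.comp (Primrec.unpair.comp hdiv)
  have hy : Primrec fun p : α × ℕ => p.2 := Primrec.snd
  have up {g : α → ℕ} (hg : Primrec g) : Primrec fun p : α × ℕ => g p.1 := hg.comp Primrec.fst
  refine PrimrecPred.and ?_ (PrimrecPred.and ?_ (PrimrecPred.and ?_ (PrimrecPred.and ?_ ?_)))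
  · exact primrecPred_imp (hmod 1)
      (primrecPred_bit_pair hl hx (Primrec.nat_sub.comp hf (Primrec.const 1))).not
  · exact primrecPred_imp (hmod 2)
      ((primrecPred_bit_pair hl hx h1).or (primrecPred_bit_pair hl hx h2))
  · exact primrecPred_imp (hmod 3)
      ((primrecPred_bit_pair hl hx h1).and (primrecPred_bit_pair hl hx h2))
  · exact primrecPred_imp (hmod 4) (primrecPred_exists_lt hN
      ((primrecPred_bit_pair (up hr) (up hx) hy).and (primrecPred_bit_pair (up hl) hy (up hdiv))))
  · exact primrecPred_imp (hmod 5) (primrecPred_forall_lt hN (primrecPred_imp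
      (primrecPred_bit_pair (up hr) (up hx) hy) (primrecPred_bit_pair (up hl) hy (up hdiv))))

theorem primrecPred_codedWalk {N r k p : α → ℕ} (hN : Primrec N) (hr : Primrec r)
    (hk : Primrec k) (hp : Primrec p) :
    PrimrecPred fun a => CodedWalk (N a) (r a) (k a) (p a) := by
  have up {g : α → ℕ} (hg : Primrec g) : Primrec fun p : α × ℕ => g p.1 := hg.comp Primrec.fst
  exact primrecPred_forall_lt hk (primrecPred_bit_pair (up hr)
    (primrec_digit (up hN) (up hp) Primrec.snd)
    (primrec_digit (up hN) (up hp) (Primrec.succ.comp Primrec.snd)))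

theorem primrecPred_codedQuasiDense {N r : α → ℕ} {q : α → QDP} (hN : Primrec N)
    (hr : Primrec r) (hq : Primrec q) :
    PrimrecPred fun a => CodedQuasiDense (N a) (r a) (q a) := by
  have hval : Primrec fun a => (q a).1 :=
    (Primrec.subtype_val (hp := primrecPred_qdp)).comp hq
  have hk : Primrec fun a => (q a).1.1 := Primrec.fst.comp hval
  have hn : Primrec fun a => (q a).1.2 := Primrec.snd.comp hval
  have up {g : α → ℕ} (hg : Primrec g) : Primrec fun p : α × ℕ => g p.1 := hg.comp Primrec.fst
  have up' {g : α → ℕ} (hg : Primrec g) : Primrec fun p : (α × ℕ) × ℕ => g p.1.1 :=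
    hg.comp (Primrec.fst.comp Primrec.fst)
  have hp : Primrec fun p : (α × ℕ) × ℕ => p.1.2 := Primrec.snd.comp Primrec.fst
  have hp' : Primrec fun p : (α × ℕ) × ℕ => p.2 := Primrec.snd
  refine primrecPred_forall_lt (primrec_pow hN (Primrec.succ.comp hk)) (primrecPred_imp
    (primrecPred_codedWalk (up hN) (up hr) (up hk) Primrec.snd)
    (primrecPred_exists_lt (primrec_pow (up hN) (Primrec.succ.comp (up hn)))
      (PrimrecPred.and ?_ (PrimrecPred.and ?_ ?_))))
  · exact primrecPred_codedWalk (up' hN) (up' hr) (up' hn) hp'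
  · exact Primrec.eq.comp (primrec_digit (up' hN) hp' (Primrec.const 0))
      (primrec_digit (up' hN) hp (Primrec.const 0))
  · exact Primrec.eq.comp (primrec_digit (up' hN) hp' (up' hn))
      (primrec_digit (up' hN) hp (up' hk))

theorem primrecPred_isCertificate {𝓟 : α → List QDP} {e N r l : α → ℕ} (h𝓟 : Primrec 𝓟)
    (he : Primrec e) (hN : Primrec N) (hr : Primrec r) (hl : Primrec l) :
    PrimrecPred fun a => IsCertificate (𝓟 a) (e a) (N a) (r a) (l a) := by
  have up {g : α → ℕ} (hg : Primrec g) : Primrec fun p : α × ℕ => g p.1 := hg.comp Primrec.fst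
  have up' {g : α → ℕ} (hg : Primrec g) : Primrec fun p : (α × ℕ) × ℕ => g p.1.1 :=
    hg.comp (Primrec.fst.comp Primrec.fst)
  have hx : Primrec fun p : (α × ℕ) × ℕ => p.1.2 := Primrec.snd.comp Primrec.fst
  refine PrimrecPred.and ?_ (PrimrecPred.and ?_ ?_)
  · exact primrecPred_exists_lt hN (primrecPred_bit_pair (up hl) Primrec.snd (up he))
  · exact primrecPred_forall_lt hN (primrecPred_forall_lt (up hN) (primrecPred_imp
      (primrecPred_bit_pair (up' hl) hx Primrec.snd)
      (primrecPred_locallyTrue (up' hN) (up' hr) (up' hl) hx Primrec.snd)))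
  · have h : PrimrecRel fun (q : QDP) (a : α) => CodedQuasiDense (N a) (r a) q :=
      primrecPred_codedQuasiDense (hN.comp Primrec.snd) (hr.comp Primrec.snd) Primrec.fst
    exact h.forall_mem_list.comp h𝓟 Primrec.id

end Primrec

theorem primrecPred_satisfiable :
    PrimrecPred fun q : List QDP × ModalFormula => Satisfiable q.1 q.2 := by
  have he : Primrec fun q : List QDP × ModalFormula => q.2.toNat :=
    (Primrec.of_equiv (e := ModalFormula.equivNat)).comp Primrec.snd
  have hb := primrec_pow (Primrec.const 2) (primrec_pow (primrec_worldBound he) (Primrec.const 2))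
  have up : Primrec fun p : ((List QDP × ModalFormula) × ℕ) × ℕ => p.1.1 :=
    Primrec.fst.comp Primrec.fst
  exact (primrecPred_exists_lt hb (primrecPred_exists_lt (hb.comp Primrec.fst)
    (primrecPred_isCertificate (Primrec.fst.comp up) (he.comp up)
      (primrec_worldBound (he.comp up)) (Primrec.snd.comp Primrec.fst) Primrec.snd))).of_eq
    fun _ => satisfiable_iff.symm

end QuasiDense

theorem lemma4p1 (a : QuasiDense.Const) :
    ComputablePred fun q : List QuasiDense.QDP × QuasiDense.ModalFormula =>
      ∃ C ∈ QuasiDense.chase (QuasiDense.database a q.2)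
          (QuasiDense.modalRules q.2 ∪ QuasiDense.qdpRules q.1),
        QuasiDense.Atom.contr ∉ C :=
  (QuasiDense.primrecPred_satisfiable.of_eq fun _ =>
    QuasiDense.exists_mem_chase_iff.symm).computablePred
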